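/- **Setting.** Let $(x_i,y_i)_{i=1}^n$ be data with $x_i\in\mathbb R^d$, $y_i\in\{1,\dots,k\}$, $k\ge 2$, every class being represented by at least one datapoint. Assume that the data are linearly separable (some $W\in\mathbb R^{k\times d}$ satisfies $(e_{y_i}-e_c)^\top Wx_i>0$ for all $i$ and all $c\ne y_i$) and that $\max_i\|x_i\|_1\le R$ with $R>0$. Let $\|\cdot\|$ be an entry-wise or Schatten $p$-norm on $\mathbb R^{k\times d}$, $1\le p\le\infty$, and $$\gamma=\max_{\|W\|\le1}\ \min_{i,\,c\neq y_i}(e_{y_i}-e_c)^\top Wx_i .$$ Let $\mathcal L(W)=\frac1n\sum_i\ell(Wx_i;y_i)$ with the cross-entropy loss $\ell(v;y)=-\log\big(e^{v_y}/\sum_j e^{v_j}\big)$. Let $n=mb$ with batch size $b\ge1$. In every epoch the index set is (randomly) partitioned into $m$ batches of size $b$, which are used one after the other; $\mathcal B_t$ is the batch of iteration $t$. Given $\beta_1\in(0,1)$, step sizes $\eta_t$, an initial point $W_0$ and $M_{-1}=0$, mini-batch steepest descent with momentum is $$M_t=\beta_1M_{t-1}+(1-\beta_1)\,\frac1b\sum_{i\in\mathcal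 B_t}\nabla_W\,\ell(W_tx_i;y_i),\qquad \Delta_t\in\arg\max_{\|\Delta\|\le1}\langle M_t,\Delta\rangle,\qquad W_{t+1}=W_t-\eta_t\Delta_t,$$ with an arbitrary choice of the maximizer. The step sizes are $\eta_t=c\,t^{-a}$ for $t\ge1$, with $c>0$ and $a\in(0,1]$, and $0\le\eta_0\le c$. **Theorem.** Assume the positive effective margin condition $$\rho:=\gamma-2(1-\beta_1)\,m(m^2-1)R>0,$$ and put $D=\dfrac{4R\eta_0}{1-\sqrt{\beta_1}}$. There is a constant $C>0$ depending only on $R,c,a,\rho$ (in particular not on $d,k,n,b,m,\beta_1,W_0$ or the norm), and a time $t_2$ depending only on $n,b,\beta_1,\gamma,W_0,R$ and the step sizes (not on the data beyond these quantities, nor on the outcome of the random partitions), such that for every $t>t_2$ we have $\mathcal L(W_t)\le\frac{\log2}{n}$ and $$\rho-\frac{\min_{i,\,c\ne y_i}(e_{y_i}-e_c)^\top W_tx_i}{\|W_t\|}\ \le\ C\cdot\frac{\displaystyle\sum_{s=0}^{t_2-1}\eta_s+\frac{m}{1-\beta_1}\sum_{s=t_2}^{t-1}\eta_s^2+\sum_{s=t_2}^{t-1}\eta_s\,e^{-\frac\rho4\sum_{\tau=t_2}^{s-1}\eta_\tau}+D}{\displaystyle\sum_{s=0}^{t-1}\eta_s}.$$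 This holds for every outcome of the random partitions. -/

import Mathlib

open scoped ENNReal Matrix

noncomputable section

namespace MarginSD

/-- The two families of matrix norms. -/
inductive NormKind
  | entrywise
  | schatten

/-- The entry-wise `p`-norm of a real `k × d` matrix, i.e. the `ℓ_p` norm of the family of all its
entries (`p = ∞` is the max-norm). Used for `1 ≤ p ≤ ∞`. -/
def entrywiseNorm {k d : ℕ} (p : ℝ≥0∞) (A : Matrix (Fin k) (Fin d) ℝ) : ℝ :=
  ‖(WithLp.toLp p (fun q : Fin k × Fin d => A q.1 q.2) : PiLp p (fun _ : Fin k × Fin d => ℝ))‖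

/-- The Schatten `p`-norm of a real `k × d` matrix, i.e. the `ℓ_p` norm of its singular values
(`p = ∞` is the spectral norm). The list of singular values has length `d`, hence may be padded
with zeros, which do not contribute. Used for `1 ≤ p ≤ ∞`. -/
def schattenNorm {k d : ℕ} (p : ℝ≥0∞) (A : Matrix (Fin k) (Fin d) ℝ) : ℝ :=
  ‖(WithLp.toLp p (fun j : Fin d => (Matrix.toEuclideanLin A).singularValues (j : ℕ)) :
    PiLp p (fun _ : Fin d => ℝ))‖

/-- The entry-wise or Schatten `p`-norm. -/
def matNorm (κ : NormKind) (p : ℝ≥0∞) {k d : ℕ} (A : Matrix (Fin k) (Fin d) ℝ) : ℝ :=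
  match κ with
  | NormKind.entrywise => entrywiseNorm p A
  | NormKind.schatten => schattenNorm p A

/-- The standard inner product `⟨A, B⟩ = tr (Aᵀ B)` of matrices. -/
def matInner {k d : ℕ} (A B : Matrix (Fin k) (Fin d) ℝ) : ℝ := (Aᵀ * B).trace

/-- The softmax map. -/
def softmax {k : ℕ} (v : Fin k → ℝ) (c : Fin k) : ℝ := Real.exp (v c) / ∑ j, Real.exp (v j)

/-- Cross-entropy loss of the linear classifier `W` on one datapoint `(x, y)`. -/
def sampleLoss {k d : ℕ} (x : Fin d → ℝ) (y : Fin k) (W : Matrix (Fin k) (Fin d) ℝ) : ℝ :=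
  -Real.log (softmax (W *ᵥ x) y)

/-- Empirical cross-entropy loss. -/
def empLoss {k d n : ℕ} (x : Fin n → Fin d → ℝ) (y : Fin n → Fin k)
    (W : Matrix (Fin k) (Fin d) ℝ) : ℝ :=
  (1 / (n : ℝ)) * ∑ i, sampleLoss (x i) (y i) W

/-- The gradient of a function of a matrix: the matrix of its partial derivatives. -/
def matGrad {k d : ℕ} (f : Matrix (Fin k) (Fin d) ℝ → ℝ) (W : Matrix (Fin k) (Fin d) ℝ) :
    Matrix (Fin k) (Fin d) ℝ :=
  Matrix.of fun r j => deriv (fun s : ℝ => f (W + s • Matrix.single r j (1 : ℝ))) 0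

/-- The mini-batch gradient `(1 / b) ∑_{i ∈ S} ∇ ℓ(W x_i; y_i)`. -/
def batchGrad {k d n : ℕ} (x : Fin n → Fin d → ℝ) (y : Fin n → Fin k) (b : ℕ)
    (S : Finset (Fin n)) (W : Matrix (Fin k) (Fin d) ℝ) : Matrix (Fin k) (Fin d) ℝ :=
  (1 / (b : ℝ)) • ∑ i ∈ S, matGrad (sampleLoss (x i) (y i)) W

/-- The unnormalized margin `min_{i, c ≠ y_i} (e_{y_i} - e_c)ᵀ W x_i`. The infimum is over a finite
index set, which is nonempty as soon as there are a datapoint and two classes. -/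
def minMargin {k d n : ℕ} (x : Fin n → Fin d → ℝ) (y : Fin n → Fin k)
    (W : Matrix (Fin k) (Fin d) ℝ) : ℝ :=
  ⨅ q : {q : Fin n × Fin k // q.2 ≠ y q.1},
    ((W *ᵥ x q.1.1) (y q.1.1) - (W *ᵥ x q.1.1) q.1.2)

/-- The maximum margin `max_{‖W‖ ≤ 1} min_{i, c ≠ y_i} (e_{y_i} - e_c)ᵀ W x_i` with respect to the
norm `N`. -/
def maxMargin {k d n : ℕ} (N : Matrix (Fin k) (Fin d) ℝ → ℝ) (x : Fin n → Fin d → ℝ)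
    (y : Fin n → Fin k) : ℝ :=
  sSup (minMargin x y '' {W | N W ≤ 1})

/-- Linear separability of the data. -/
def LinearlySeparable {k d n : ℕ} (x : Fin n → Fin d → ℝ) (y : Fin n → Fin k) : Prop :=
  ∃ W : Matrix (Fin k) (Fin d) ℝ, ∀ i, ∀ c, c ≠ y i → 0 < (W *ᵥ x i) (y i) - (W *ᵥ x i) c

/-- `Δ` is a steepest descent direction for the signal `G`: a maximizer of `⟨G, ·⟩` over the unit
ball of the norm `N` (any maximizer is allowed). -/
def IsSteepestDirection {k d : ℕ} (N : Matrix (Fin k) (Fin d) ℝ → ℝ)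
    (G Δ : Matrix (Fin k) (Fin d) ℝ) : Prop :=
  N Δ ≤ 1 ∧ ∀ Δ' : Matrix (Fin k) (Fin d) ℝ, N Δ' ≤ 1 → matInner G Δ' ≤ matInner G Δ

/-- `B t` is the mini-batch used at iteration `t`. The batches have size `b`, and in each epoch
`e` the `m` batches `B (e m), …, B (e m + m - 1)` partition the index set: `B` is a possible
outcome of random reshuffling. -/
structure IsReshuffling {n : ℕ} (b m : ℕ) (B : ℕ → Finset (Fin n)) : Prop where
  card_eq : ∀ t, (B t).card = b
  disjoint : ∀ e j j' : ℕ, j < m → j' < m → j ≠ j' → Disjoint (B (e * m + j)) (B (e * m + j'))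
  cover : ∀ (e : ℕ) (i : Fin n), ∃ j < m, i ∈ B (e * m + j)

/-- `W` (iterates), `M` (momentum buffers) and `Δ` (directions) form a run of mini-batch steepest
descent with EMA momentum `β₁`, started at `W₀` with `M_{-1} = 0`. -/
structure IsMomentumRun {k d n : ℕ} (N : Matrix (Fin k) (Fin d) ℝ → ℝ) (x : Fin n → Fin d → ℝ)
    (y : Fin n → Fin k) (b : ℕ) (B : ℕ → Finset (Fin n)) (β₁ : ℝ) (η : ℕ → ℝ)
    (W₀ : Matrix (Fin k) (Fin d) ℝ) (W M Δ : ℕ → Matrix (Fin k) (Fin d) ℝ) : Prop where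
  init : W 0 = W₀
  momentum_zero : M 0 = (1 - β₁) • batchGrad x y b (B 0) (W 0)
  momentum_succ : ∀ t, M (t + 1) =
    β₁ • M t + (1 - β₁) • batchGrad x y b (B (t + 1)) (W (t + 1))
  direction : ∀ t, IsSteepestDirection N (M t) (Δ t)
  step : ∀ t, W (t + 1) = W t - η t • Δ t

end MarginSD

end

/-! Write `G` for the average softmax probability of the wrong labels. As a linear functional, the
momentum buffer is the full gradient at the current iterate with each (datapoint, class) term
multiplied by a weight near 1 (`IsMomentumRun.exists_momentum_eq`). Two effects move the weights
away from 1. Reshuffling contributes at most (1 - β)m(m² - 1)/2 plus a geometric tail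
(`abs_mul_emaWeight_sub_one_le`). The drift of the iterates contributes a lag of order Rm/(1 - β)
times the step size (`eventually_momentumLag_le`), because one step changes every softmax
probability by a factor of at most exp(2Rη).

Weights within q of 1 cost 4Rq of the margin in the slope along the steepest direction
(`IsSteepestDirection.le_avgSlope`). The reshuffling part of this cost is exactly γ - ρ. Hence, once
the step sizes are small, L(t+1) ≤ L(t) - η(ρ - κη)G with κ = (4R + 36R²)m/(1 - β)
(`IsMomentumRun.empLoss_succ_le_of_lag_le`).

The rest is a scalar recursion. Above log 2 / n, `G` is bounded below, and since the step sizes are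
not summable the loss gets under this threshold. There G ≥ L(1 - nL/2). This first gives decay at
rate ρ/4, and inserting that decay into the same inequality gives the sharp rate ρ, up to the sums
of squares and of exponentially damped step sizes (`sharp_decay_of_descent`). A small loss forces a
large margin (`le_minMargin_of_empLoss_le`), the norm of the iterate grows by at most the sum of the
step sizes, and the quotient is the claim.

Only two bounds on the norm enter: it dominates every entry, which controls the logits through the
ℓ₁ bound on the data, and it is at most the sum of the absolute entries, which bounds the initial
norm uniformly in the choice of norm. -/

noncomputable section

/-! ### Norms between the largest entry and the sum of the entries. -/

namespace MarginSD

/-- The properties of a matrix norm on which the margin analysis depends: it is a seminorm that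
lies between the largest absolute value of an entry and the sum of these absolute values. -/
structure IsEntryControlledNorm {k d : ℕ} (N : Matrix (Fin k) (Fin d) ℝ → ℝ) : Prop where
  add_le : ∀ A B, N (A + B) ≤ N A + N B
  smul_eq : ∀ (s : ℝ) A, N (s • A) = |s| * N A
  entry_le : ∀ A r j, |A r j| ≤ N A
  le_sum : ∀ A, N A ≤ ∑ r, ∑ j, |A r j|

namespace IsEntryControlledNorm

variable {k d : ℕ} {N : Matrix (Fin k) (Fin d) ℝ → ℝ}

theorem map_zero (hN : IsEntryControlledNorm N) : N 0 = 0 := by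
  have h := hN.smul_eq 0 0
  rwa [zero_smul, abs_zero, zero_mul] at h

theorem neg_eq (hN : IsEntryControlledNorm N) (U : Matrix (Fin k) (Fin d) ℝ) : N (-U) = N U := by
  have h := hN.smul_eq (-1) U
  simpa using h

theorem nonneg (hN : IsEntryControlledNorm N) (U : Matrix (Fin k) (Fin d) ℝ) : 0 ≤ N U := by
  have h := hN.add_le U (-U)
  rw [add_neg_cancel, hN.map_zero, hN.neg_eq] at h
  linarith

theorem eq_zero_of_map_eq_zero (hN : IsEntryControlledNorm N) {U : Matrix (Fin k) (Fin d) ℝ}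
    (hU : N U = 0) : U = 0 := by
  ext r j
  exact abs_nonpos_iff.1 ((hN.entry_le U r j).trans_eq hU)

end IsEntryControlledNorm

section LpNorm

variable {ι : Type*} [Fintype ι] {p : ℝ≥0∞}

theorem abs_le_norm_toLp (hp : 1 ≤ p) (f : ι → ℝ) (i : ι) :
    |f i| ≤ ‖(WithLp.toLp p f : PiLp p (fun _ : ι => ℝ))‖ := by
  have : Fact (1 ≤ p) := ⟨hp⟩
  simpa using PiLp.norm_apply_le (WithLp.toLp p f : PiLp p (fun _ : ι => ℝ)) i

theorem norm_toLp_le_sum_abs (hp : 1 ≤ p) (f : ι → ℝ) :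
    ‖(WithLp.toLp p f : PiLp p (fun _ : ι => ℝ))‖ ≤ ∑ i, |f i| := by
  classical
  have : Fact (1 ≤ p) := ⟨hp⟩
  have h : (WithLp.toLp p f : PiLp p (fun _ : ι => ℝ))
      = ∑ i, (PiLp.single p i (f i) : PiLp p (fun _ : ι => ℝ)) := by
    ext j
    simp [WithLp.ofLp_sum, Finset.sum_apply, Pi.single_apply]
  rw [h]
  refine (norm_sum_le _ _).trans (Finset.sum_le_sum fun i _ => ?_)
  simp

/-- The image of a vector under a doubly substochastic matrix has at most the same `ℓ_p` norm. -/
theorem norm_toLp_le_of_substochastic {ι' : Type*} [Fintype ι'] (hp : 1 ≤ p) (P : ι → ι' → ℝ)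
    (hP : ∀ i j, 0 ≤ P i j) (hrow : ∀ i, ∑ j, P i j ≤ 1) (hcol : ∀ j, ∑ i, P i j ≤ 1)
    (f : ι → ℝ) (σ : ι' → ℝ) (hσ : ∀ j, 0 ≤ σ j) (hf : ∀ i, |f i| ≤ ∑ j, P i j * σ j) :
    ‖(WithLp.toLp p f : PiLp p (fun _ : ι => ℝ))‖
      ≤ ‖(WithLp.toLp p σ : PiLp p (fun _ : ι' => ℝ))‖ := by
  have : Fact (1 ≤ p) := ⟨hp⟩
  by_cases htop : p = ∞
  · subst htop
    rw [PiLp.norm_eq_ciSup]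
    refine Real.iSup_le (fun i => ?_) (norm_nonneg _)
    have h : ∀ j, P i j * σ j
        ≤ P i j * ‖(WithLp.toLp ∞ σ : PiLp ∞ (fun _ : ι' => ℝ))‖ := fun j =>
      mul_le_mul_of_nonneg_left ((le_abs_self _).trans (abs_le_norm_toLp le_top σ j)) (hP i j)
    calc ‖f i‖ ≤ ∑ j, P i j * σ j := hf i
      _ ≤ ∑ j, P i j * ‖(WithLp.toLp ∞ σ : PiLp ∞ (fun _ : ι' => ℝ))‖ :=
        Finset.sum_le_sum fun j _ => h j
      _ = (∑ j, P i j) * ‖(WithLp.toLp ∞ σ : PiLp ∞ (fun _ : ι' => ℝ))‖ := by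
        rw [Finset.sum_mul]
      _ ≤ _ := mul_le_of_le_one_left (norm_nonneg _) (hrow i)
  · have hp1 : 1 ≤ p.toReal := by
      rw [← ENNReal.toReal_one]; exact ENNReal.toReal_mono htop hp
    have hp0 : 0 < p.toReal := by linarith
    rw [PiLp.norm_eq_sum hp0, PiLp.norm_eq_sum hp0]
    refine Real.rpow_le_rpow (Finset.sum_nonneg fun i _ => by positivity) ?_ (by positivity)
    have key : ∀ i, |f i| ^ p.toReal ≤ ∑ j, P i j * σ j ^ p.toReal := by
      intro i
      -- Weighted Hölder: the row sums remove the factor carrying the total mass, and the column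
      -- sums enter below, after the two summations are exchanged.
      have h1 := Real.inner_le_weight_mul_Lp_of_nonneg Finset.univ hp1 (P i) σ (hP i) hσ
      have hs : 0 ≤ ∑ j, P i j * σ j ^ p.toReal :=
        Finset.sum_nonneg fun j _ => mul_nonneg (hP i j) (Real.rpow_nonneg (hσ j) _)
      have h2 : (∑ j, P i j) ^ (1 - p.toReal⁻¹) ≤ 1 :=
        Real.rpow_le_one (Finset.sum_nonneg fun j _ => hP i j) (hrow i)
          (sub_nonneg.2 (inv_le_one_of_one_le₀ hp1))
      have h3 : |f i| ≤ (∑ j, P i j * σ j ^ p.toReal) ^ p.toReal⁻¹ :=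
        (hf i).trans (h1.trans (mul_le_of_le_one_left (Real.rpow_nonneg hs _) h2))
      calc |f i| ^ p.toReal ≤ ((∑ j, P i j * σ j ^ p.toReal) ^ p.toReal⁻¹) ^ p.toReal :=
            Real.rpow_le_rpow (abs_nonneg _) h3 hp0.le
        _ = _ := Real.rpow_inv_rpow hs hp0.ne'
    calc ∑ i, ‖f i‖ ^ p.toReal ≤ ∑ i, ∑ j, P i j * σ j ^ p.toReal :=
          Finset.sum_le_sum fun i _ => key i
      _ = ∑ j, (∑ i, P i j) * σ j ^ p.toReal := by
          rw [Finset.sum_comm]; simp [Finset.sum_mul]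
      _ ≤ ∑ j, ‖σ j‖ ^ p.toReal := by
          refine Finset.sum_le_sum fun j _ => ?_
          rw [Real.norm_of_nonneg (hσ j)]
          exact mul_le_of_le_one_left (Real.rpow_nonneg (hσ j) _) (hcol j)

end LpNorm

theorem isEntryControlledNorm_entrywiseNorm {k d : ℕ} {p : ℝ≥0∞} (hp : 1 ≤ p) :
    IsEntryControlledNorm (entrywiseNorm p (k := k) (d := d)) := by
  have : Fact (1 ≤ p) := ⟨hp⟩
  refine ⟨fun A B => ?_, fun s A => ?_, fun A r j => ?_, fun A => ?_⟩
  · exact norm_add_le (WithLp.toLp p (fun q : Fin k × Fin d => A q.1 q.2) : PiLp p _)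
      (WithLp.toLp p (fun q : Fin k × Fin d => B q.1 q.2))
  · exact norm_smul s (WithLp.toLp p (fun q : Fin k × Fin d => A q.1 q.2) : PiLp p _)
  · exact abs_le_norm_toLp hp (fun q : Fin k × Fin d => A q.1 q.2) (r, j)
  · refine (norm_toLp_le_sum_abs hp _).trans_eq ?_
    rw [Fintype.sum_prod_type]

/-! ### Bessel's inequality and Schatten norms. -/

section SubOrthonormal

open scoped InnerProductSpace

variable {ι E : Type*} [NormedAddCommGroup E] [InnerProductSpace ℝ E]

/-- Pairwise orthogonal vectors in the unit ball; some of them may vanish. -/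
def SubOrthonormal (u : ι → E) : Prop :=
  (∀ i, ‖u i‖ ≤ 1) ∧ ∀ i j, i ≠ j → ⟪u i, u j⟫_ℝ = 0

/-- Bessel's inequality does not need unit length: the combination y of the `u i` with coefficients
⟪u i, x⟫ satisfies ⟪y, x⟫ = S and ‖y‖² ≤ S, and Cauchy–Schwarz gives S² ≤ S‖x‖². -/
theorem SubOrthonormal.sum_sq_inner_le [Fintype ι] {u : ι → E} (hu : SubOrthonormal u) (x : E) :
    ∑ i, ⟪u i, x⟫_ℝ ^ 2 ≤ ‖x‖ ^ 2 := by
  classical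
  set S := ∑ i, ⟪u i, x⟫_ℝ ^ 2 with hS
  have hS0 : 0 ≤ S := Finset.sum_nonneg fun i _ => sq_nonneg _
  set y := ∑ i, ⟪u i, x⟫_ℝ • u i with hy
  have h1 : ⟪y, x⟫_ℝ = S := by
    rw [hy, sum_inner, hS]
    exact Finset.sum_congr rfl fun i _ => by rw [real_inner_smul_left, sq]
  have h2 : ‖y‖ ^ 2 ≤ S := by
    rw [← real_inner_self_eq_norm_sq]
    nth_rewrite 1 [hy]
    rw [sum_inner, hS]
    refine Finset.sum_le_sum fun i _ => ?_
    have h3 : ⟪u i, y⟫_ℝ = ⟪u i, x⟫_ℝ * ‖u i‖ ^ 2 := by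
      rw [hy, inner_sum, Finset.sum_eq_single i]
      · rw [real_inner_smul_right, real_inner_self_eq_norm_sq]
      · intro j _ hj
        rw [real_inner_smul_right, hu.2 i j hj.symm, mul_zero]
      · simp
    rw [real_inner_smul_left, h3]
    have h4 : ‖u i‖ ^ 2 ≤ 1 := pow_le_one₀ (norm_nonneg _) (hu.1 i)
    nlinarith [sq_nonneg ⟪u i, x⟫_ℝ]
  have h5 : S ≤ ‖y‖ * ‖x‖ := h1 ▸ real_inner_le_norm y x
  by_contra hlt
  push Not at hlt
  have h6 : S ^ 2 ≤ (‖y‖ * ‖x‖) ^ 2 := pow_le_pow_left₀ hS0 h5 2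
  nlinarith [sq_nonneg ‖x‖, mul_le_mul_of_nonneg_right h2 (sq_nonneg ‖x‖)]

theorem _root_.Orthonormal.subOrthonormal {u : ι → E} (hu : Orthonormal ℝ u) :
    SubOrthonormal u :=
  ⟨fun i => (hu.1 i).le, fun _ _ h => hu.2 h⟩

end SubOrthonormal

section Schatten

open scoped InnerProductSpace

variable {k d : ℕ}

/-- Singular value decomposition of a real matrix. -/
theorem exists_singular_system (A : Matrix (Fin k) (Fin d) ℝ) :
    ∃ (v : OrthonormalBasis (Fin d) ℝ (EuclideanSpace ℝ (Fin d)))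
      (u : Fin d → EuclideanSpace ℝ (Fin k)), SubOrthonormal u ∧
      (∀ j, Matrix.toEuclideanLin A (v j) = (Matrix.toEuclideanLin A).singularValues j • u j) ∧
      ∀ j, ⟪u j, Matrix.toEuclideanLin A (v j)⟫_ℝ
        = (Matrix.toEuclideanLin A).singularValues j := by
  set T := Matrix.toEuclideanLin A with hT
  have hn : Module.finrank ℝ (EuclideanSpace ℝ (Fin d)) = d := finrank_euclideanSpace_fin
  set v := T.isSymmetric_adjoint_comp_self.eigenvectorBasis hn with hv
  have hin : ∀ i j, ⟪T (v i), T (v j)⟫_ℝ = if i = j then T.singularValues j ^ 2 else 0 := by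
    intro i j
    have h1 := T.isSymmetric_adjoint_comp_self.apply_eigenvectorBasis hn j
    rw [← T.sq_singularValues_fin hn j] at h1
    rw [← LinearMap.adjoint_inner_right]
    change ⟪v i, (LinearMap.adjoint T ∘ₗ T) (v j)⟫_ℝ = _
    rw [h1, RCLike.ofReal_real_eq_id, id, real_inner_smul_right,
      orthonormal_iff_ite.1 v.orthonormal i j]
    split_ifs <;> simp
  -- Since 0⁻¹ = 0, the left vector is 0 where the singular value vanishes. Full orthonormality is
  -- impossible when d > k.
  refine ⟨v, fun j => (T.singularValues j)⁻¹ • T (v j), ⟨fun i => ?_, fun i j hij => ?_⟩,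
    fun j => ?_, fun j => ?_⟩
  · have h2 : ‖T (v i)‖ = T.singularValues i := by
      have := hin i i
      rw [real_inner_self_eq_norm_sq, if_pos rfl] at this
      exact (sq_eq_sq₀ (norm_nonneg _) (T.singularValues_nonneg i)).1 this
    rw [norm_smul, h2, Real.norm_of_nonneg (inv_nonneg.2 (T.singularValues_nonneg i))]
    exact inv_mul_le_one
  · rw [real_inner_smul_left, real_inner_smul_right, hin i j, if_neg hij]
    simp
  · by_cases h0 : T.singularValues j = 0
    · have h3 := hin j j
      rw [if_pos rfl, h0] at h3
      have h4 : T (v j) = 0 := inner_self_eq_zero.1 (by rw [h3]; simp)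
      rw [h0, h4, zero_smul]
    · rw [smul_smul, mul_inv_cancel₀ h0, one_smul]
  · rw [real_inner_smul_left, hin j j, if_pos rfl]
    by_cases h0 : T.singularValues j = 0
    · simp [h0]
    · field_simp

/-- With `exists_schattenNorm_eq` this makes the Schatten norm a maximum of ℓ_p norms that depend
linearly on `A`, so the triangle inequality is inherited. The singular value decomposition gives ⟪u
i, A v i⟫ = ∑ σ_j ⟪v' j, v i⟫⟪u i, u' j⟫. By the AM-GM inequality the coefficients are dominated by
averages of squares, and these form a doubly substochastic matrix by Bessel. -/
theorem norm_inner_system_le_schattenNorm {ι : Type*} [Fintype ι] {p : ℝ≥0∞} (hp : 1 ≤ p)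
    (A : Matrix (Fin k) (Fin d) ℝ) {u : ι → EuclideanSpace ℝ (Fin k)}
    {v : ι → EuclideanSpace ℝ (Fin d)} (hu : SubOrthonormal u) (hv : SubOrthonormal v) :
    ‖(WithLp.toLp p (fun i => ⟪u i, Matrix.toEuclideanLin A (v i)⟫_ℝ) :
      PiLp p (fun _ : ι => ℝ))‖ ≤ schattenNorm p A := by
  obtain ⟨v', u', hu', hA, -⟩ := exists_singular_system A
  have hv' := v'.orthonormal.subOrthonormal
  have hsq : ∀ {F : Type} [NormedAddCommGroup F] (w : F), ‖w‖ ≤ 1 → ‖w‖ ^ 2 ≤ 1 :=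
    fun w hw => pow_le_one₀ (norm_nonneg _) hw
  refine norm_toLp_le_of_substochastic hp
    (fun i j => (⟪v' j, v i⟫_ℝ ^ 2 + ⟪u' j, u i⟫_ℝ ^ 2) / 2) (fun i j => by positivity)
    (fun i => ?_) (fun j => ?_) _ _ (fun j => LinearMap.singularValues_nonneg _ _) (fun i => ?_)
  · rw [← Finset.sum_div, Finset.sum_add_distrib]
    linarith [hv'.sum_sq_inner_le (v i), hu'.sum_sq_inner_le (u i), hsq _ (hv.1 i),
      hsq _ (hu.1 i)]
  · simp_rw [real_inner_comm _ (v' j), real_inner_comm _ (u' j)]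
    rw [← Finset.sum_div, Finset.sum_add_distrib]
    linarith [hv.sum_sq_inner_le (v' j), hu.sum_sq_inner_le (u' j), hsq _ (hv'.1 j),
      hsq _ (hu'.1 j)]
  · have h1 : Matrix.toEuclideanLin A (v i)
        = ∑ j, ⟪v' j, v i⟫_ℝ • (Matrix.toEuclideanLin A).singularValues j • u' j := by
      conv_lhs => rw [← v'.sum_repr' (v i), map_sum]
      simp_rw [map_smul, hA]
    rw [h1, inner_sum]
    refine (Finset.abs_sum_le_sum_abs _ _).trans (Finset.sum_le_sum fun j _ => ?_)
    rw [real_inner_smul_right, real_inner_smul_right, abs_mul, abs_mul,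
      abs_of_nonneg (LinearMap.singularValues_nonneg _ _), real_inner_comm (u' j) (u i)]
    have h2 := two_mul_le_add_sq |⟪v' j, v i⟫_ℝ| |⟪u' j, u i⟫_ℝ|
    rw [sq_abs, sq_abs] at h2
    nlinarith [(Matrix.toEuclideanLin A).singularValues_nonneg j]

theorem exists_schattenNorm_eq (p : ℝ≥0∞) (A : Matrix (Fin k) (Fin d) ℝ) :
    ∃ (u : Fin d → EuclideanSpace ℝ (Fin k)) (v : Fin d → EuclideanSpace ℝ (Fin d)),
      SubOrthonormal u ∧ SubOrthonormal v ∧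
      schattenNorm p A = ‖(WithLp.toLp p (fun i => ⟪u i, Matrix.toEuclideanLin A (v i)⟫_ℝ) :
        PiLp p (fun _ : Fin d => ℝ))‖ := by
  obtain ⟨v, u, hu, -, hA⟩ := exists_singular_system A
  exact ⟨u, v, hu, v.orthonormal.subOrthonormal, by simp_rw [hA]; rfl⟩

theorem inner_toEuclideanLin_eq (A : Matrix (Fin k) (Fin d) ℝ) (u : EuclideanSpace ℝ (Fin k))
    (v : EuclideanSpace ℝ (Fin d)) :
    ⟪u, Matrix.toEuclideanLin A v⟫_ℝ = ∑ r, ∑ j, A r j * (u r * v j) := by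
  simp only [PiLp.inner_apply, Matrix.toLpLin_apply, Matrix.mulVec, dotProduct,
    RCLike.inner_apply, conj_trivial, Finset.sum_mul]
  exact Finset.sum_congr rfl fun r _ => Finset.sum_congr rfl fun j _ => by ring

theorem isEntryControlledNorm_schattenNorm {p : ℝ≥0∞} (hp : 1 ≤ p) :
    IsEntryControlledNorm (schattenNorm p (k := k) (d := d)) := by
  have : Fact (1 ≤ p) := ⟨hp⟩
  have hsmul : ∀ (s : ℝ) (A : Matrix (Fin k) (Fin d) ℝ),
      schattenNorm p (s • A) ≤ |s| * schattenNorm p A := by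
    intro s A
    obtain ⟨u, v, hu, hv, h⟩ := exists_schattenNorm_eq p (s • A)
    have h1 : (WithLp.toLp p (fun i => ⟪u i, Matrix.toEuclideanLin (s • A) (v i)⟫_ℝ) :
        PiLp p (fun _ : Fin d => ℝ))
        = s • WithLp.toLp p (fun i => ⟪u i, Matrix.toEuclideanLin A (v i)⟫_ℝ) := by
      ext i
      simp [real_inner_smul_right]
    rw [h, h1, norm_smul, Real.norm_eq_abs]
    exact mul_le_mul_of_nonneg_left (norm_inner_system_le_schattenNorm hp A hu hv)
      (abs_nonneg s)
  refine ⟨fun A B => ?_, fun s A => (hsmul s A).antisymm ?_, fun A r j => ?_, fun A => ?_⟩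
  · obtain ⟨u, v, hu, hv, h⟩ := exists_schattenNorm_eq p (A + B)
    have h1 : (WithLp.toLp p (fun i => ⟪u i, Matrix.toEuclideanLin (A + B) (v i)⟫_ℝ) :
        PiLp p (fun _ : Fin d => ℝ))
        = WithLp.toLp p (fun i => ⟪u i, Matrix.toEuclideanLin A (v i)⟫_ℝ)
          + WithLp.toLp p (fun i => ⟪u i, Matrix.toEuclideanLin B (v i)⟫_ℝ) := by
      ext i
      simp [inner_add_right]
    rw [h, h1]
    exact (norm_add_le _ _).trans (add_le_add (norm_inner_system_le_schattenNorm hp A hu hv)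
      (norm_inner_system_le_schattenNorm hp B hu hv))
  · by_cases hs : s = 0
    · rw [hs, abs_zero, zero_mul]; exact norm_nonneg _
    · have h1 := hsmul s⁻¹ (s • A)
      rw [smul_smul, inv_mul_cancel₀ hs, one_smul, abs_inv] at h1
      have h2 : 0 < |s| := abs_pos.2 hs
      calc |s| * schattenNorm p A ≤ |s| * (|s|⁻¹ * schattenNorm p (s • A)) :=
            mul_le_mul_of_nonneg_left h1 h2.le
        _ = schattenNorm p (s • A) := by field_simp
  · have hsub : ∀ (q : ℕ) (r : Fin q), SubOrthonormal
        (fun _ : Unit => (EuclideanSpace.single r (1 : ℝ) : EuclideanSpace ℝ (Fin q))) :=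
      fun q r => ⟨fun _ => by simp, fun i j h => absurd (Subsingleton.elim i j) h⟩
    have h1 := (abs_le_norm_toLp hp _ ()).trans
      (norm_inner_system_le_schattenNorm hp A (hsub k r) (hsub d j))
    rw [inner_toEuclideanLin_eq] at h1
    simpa [Pi.single_apply] using h1
  · obtain ⟨u, v, hu, hv, h⟩ := exists_schattenNorm_eq p A
    rw [h]
    refine (norm_toLp_le_sum_abs hp _).trans ?_
    -- Splitting |u i r · v i j| into squares lets the sum over i be bounded by 1 for each entry, by
    -- Bessel against the standard basis vectors.
    have h1 : ∀ i, |⟪u i, Matrix.toEuclideanLin A (v i)⟫_ℝ|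
        ≤ ∑ r, ∑ j, |A r j| * ((u i r ^ 2 + v i j ^ 2) / 2) := by
      intro i
      rw [inner_toEuclideanLin_eq]
      refine (Finset.abs_sum_le_sum_abs _ _).trans (Finset.sum_le_sum fun r _ =>
        (Finset.abs_sum_le_sum_abs _ _).trans (Finset.sum_le_sum fun j _ => ?_))
      rw [abs_mul, abs_mul]
      refine mul_le_mul_of_nonneg_left ?_ (abs_nonneg _)
      have := two_mul_le_add_sq |u i r| |v i j|
      rw [sq_abs, sq_abs] at this
      linarith
    have hcoord : ∀ {q : ℕ} {w : Fin d → EuclideanSpace ℝ (Fin q)}, SubOrthonormal w →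
        ∀ r, ∑ i, w i r ^ 2 ≤ 1 := by
      intro q w hw r
      have := hw.sum_sq_inner_le (EuclideanSpace.single r (1 : ℝ))
      simpa [EuclideanSpace.inner_single_right] using this
    refine (Finset.sum_le_sum fun i _ => h1 i).trans ?_
    rw [Finset.sum_comm]
    refine Finset.sum_le_sum fun r _ => ?_
    rw [Finset.sum_comm]
    refine Finset.sum_le_sum fun j _ => ?_
    rw [← Finset.mul_sum, ← Finset.sum_div, Finset.sum_add_distrib]
    exact mul_le_of_le_one_right (abs_nonneg _) (by linarith [hcoord hu r, hcoord hv j])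

end Schatten

theorem isEntryControlledNorm_matNorm {k d : ℕ} (κ : NormKind) {p : ℝ≥0∞} (hp : 1 ≤ p) :
    IsEntryControlledNorm (matNorm κ p (k := k) (d := d)) := by
  cases κ
  · exact isEntryControlledNorm_entrywiseNorm hp
  · exact isEntryControlledNorm_schattenNorm hp

end MarginSD

end

/-! ### The cross-entropy loss of a single datapoint. -/

noncomputable section

namespace MarginSD

section Sample

variable {k d : ℕ}

/-- The logits of `W` at `x`, relative to the logit of the label `y`. -/
def logitGap (x : Fin d → ℝ) (y : Fin k) (W : Matrix (Fin k) (Fin d) ℝ) (c : Fin k) : ℝ :=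
  (W *ᵥ x) c - (W *ᵥ x) y

/-- The probability that the softmax classifier gives to the wrong labels. -/
def errorProb (x : Fin d → ℝ) (y : Fin k) (W : Matrix (Fin k) (Fin d) ℝ) : ℝ :=
  ∑ c ∈ Finset.univ.erase y, softmax (W *ᵥ x) c

/-- The directional derivative of the sample loss at `W` in the direction `U`. -/
def lossSlope (x : Fin d → ℝ) (y : Fin k) (W U : Matrix (Fin k) (Fin d) ℝ) : ℝ :=
  ∑ c, softmax (W *ᵥ x) c * logitGap x y U c

variable (x : Fin d → ℝ) (y : Fin k)

@[simp] theorem logitGap_self (W : Matrix (Fin k) (Fin d) ℝ) : logitGap x y W y = 0 := by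
  simp [logitGap]

theorem logitGap_add (W U : Matrix (Fin k) (Fin d) ℝ) (c : Fin k) :
    logitGap x y (W + U) c = logitGap x y W c + logitGap x y U c := by
  simp only [logitGap, Matrix.add_mulVec, Pi.add_apply]; ring

theorem logitGap_smul (s : ℝ) (W : Matrix (Fin k) (Fin d) ℝ) (c : Fin k) :
    logitGap x y (s • W) c = s * logitGap x y W c := by
  simp only [logitGap, Matrix.smul_mulVec, Pi.smul_apply, smul_eq_mul]; ring

theorem logitGap_sum {ι : Type*} (S : Finset ι) (W : ι → Matrix (Fin k) (Fin d) ℝ) (c : Fin k) :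
    logitGap x y (∑ i ∈ S, W i) c = ∑ i ∈ S, logitGap x y (W i) c := by
  simp only [logitGap, Matrix.sum_mulVec, Finset.sum_apply, Finset.sum_sub_distrib]

variable {x y}

theorem abs_mulVec_sub_le {R s : ℝ} (hx : ∑ j, |x j| ≤ R) {U : Matrix (Fin k) (Fin d) ℝ}
    (hs : 0 ≤ s) (hU : ∀ r j, |U r j| ≤ s) (a b : Fin k) :
    |(U *ᵥ x) a - (U *ᵥ x) b| ≤ 2 * R * s := by
  have h : ∀ r, |(U *ᵥ x) r| ≤ s * R := by
    intro r
    rw [Matrix.mulVec, dotProduct]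
    refine (Finset.abs_sum_le_sum_abs _ _).trans ?_
    refine le_trans ?_ (mul_le_mul_of_nonneg_left hx hs)
    rw [Finset.mul_sum]
    refine Finset.sum_le_sum fun j _ => ?_
    rw [abs_mul]
    exact mul_le_mul_of_nonneg_right (hU r j) (abs_nonneg _)
  have h1 := norm_sub_le ((U *ᵥ x) a) ((U *ᵥ x) b)
  simp only [Real.norm_eq_abs] at h1
  linarith [h a, h b]

variable (x y)

theorem sum_exp_pos (v : Fin k → ℝ) (c : Fin k) : 0 < ∑ j, Real.exp (v j) :=
  Finset.sum_pos (fun _ _ => Real.exp_pos _) ⟨c, Finset.mem_univ c⟩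

theorem softmax_pos (v : Fin k → ℝ) (c : Fin k) : 0 < softmax v c :=
  div_pos (Real.exp_pos _) (sum_exp_pos v c)

theorem sum_softmax (v : Fin k → ℝ) (c : Fin k) : ∑ j, softmax v j = 1 := by
  simp only [softmax]
  rw [← Finset.sum_div, div_self (sum_exp_pos v c).ne']

theorem softmax_eq_logitGap (W : Matrix (Fin k) (Fin d) ℝ) (c : Fin k) :
    softmax (W *ᵥ x) c = Real.exp (logitGap x y W c) / ∑ j, Real.exp (logitGap x y W j) := by
  simp only [softmax, logitGap, Real.exp_sub]
  rw [← Finset.sum_div, div_div_div_cancel_right₀ (Real.exp_pos _).ne']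

theorem sampleLoss_eq (W : Matrix (Fin k) (Fin d) ℝ) :
    sampleLoss x y W = Real.log (∑ c, Real.exp (logitGap x y W c)) := by
  rw [sampleLoss, softmax_eq_logitGap x y W y, logitGap_self, Real.exp_zero, one_div, Real.log_inv,
    neg_neg]

theorem exp_sampleLoss (W : Matrix (Fin k) (Fin d) ℝ) :
    Real.exp (sampleLoss x y W) = ∑ c, Real.exp (logitGap x y W c) := by
  rw [sampleLoss_eq, Real.exp_log (sum_exp_pos _ y)]

/-- The sum of exponentials equal to exp(loss) contains the summand 1 from the label and the summand
of `c`. This is how a small loss is converted into a margin. -/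
theorem exp_logitGap_le (W : Matrix (Fin k) (Fin d) ℝ) {c : Fin k} (hc : c ≠ y) :
    Real.exp (logitGap x y W c) ≤ Real.exp (sampleLoss x y W) - 1 := by
  have h := Finset.add_le_sum (s := Finset.univ) (f := fun c => Real.exp (logitGap x y W c))
    (fun c _ => (Real.exp_pos _).le) (Finset.mem_univ c) (Finset.mem_univ y) hc
  rw [← exp_sampleLoss, logitGap_self, Real.exp_zero] at h
  linarith

theorem sampleLoss_nonneg (W : Matrix (Fin k) (Fin d) ℝ) : 0 ≤ sampleLoss x y W := by
  rw [← Real.one_le_exp_iff, exp_sampleLoss]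
  have h := Finset.single_le_sum (f := fun c => Real.exp (logitGap x y W c))
    (fun c _ => (Real.exp_pos _).le) (Finset.mem_univ y)
  simpa using h

theorem sampleLoss_le_of_logitGap_le {W : Matrix (Fin k) (Fin d) ℝ} {s : ℝ}
    (h : ∀ c, logitGap x y W c ≤ s) : sampleLoss x y W ≤ Real.log k + s := by
  have hk : (0 : ℝ) < k := by exact_mod_cast y.pos
  rw [← Real.exp_le_exp, exp_sampleLoss, Real.exp_add, Real.exp_log hk]
  refine (Finset.sum_le_sum fun c _ => Real.exp_le_exp.2 (h c)).trans_eq ?_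
  simp

theorem sampleLoss_zero : sampleLoss x y (0 : Matrix (Fin k) (Fin d) ℝ) = Real.log k := by
  simp [sampleLoss_eq, logitGap]

theorem errorProb_nonneg (W : Matrix (Fin k) (Fin d) ℝ) : 0 ≤ errorProb x y W :=
  Finset.sum_nonneg fun _ _ => (softmax_pos _ _).le

theorem errorProb_eq (W : Matrix (Fin k) (Fin d) ℝ) :
    errorProb x y W = 1 - Real.exp (-sampleLoss x y W) := by
  have h := Finset.sum_erase_add Finset.univ (softmax (W *ᵥ x)) (Finset.mem_univ y)
  rw [sum_softmax _ y] at h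
  rw [sampleLoss, neg_neg, Real.exp_log (softmax_pos _ _), errorProb]
  linarith

theorem sub_sq_half_le_one_sub_exp_neg {l : ℝ} (hl : 0 ≤ l) :
    l - l ^ 2 / 2 ≤ 1 - Real.exp (-l) := by
  have h1 := Real.quadratic_le_exp_of_nonneg hl
  have h2 : Real.exp (-l) * (1 + l + l ^ 2 / 2) ≤ 1 := by
    calc Real.exp (-l) * (1 + l + l ^ 2 / 2) ≤ Real.exp (-l) * Real.exp l :=
          mul_le_mul_of_nonneg_left h1 (Real.exp_pos _).le
      _ = 1 := by rw [← Real.exp_add]; simp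
  -- The product equals 1 + l⁴/4.
  have h3 : 1 ≤ (1 - l + l ^ 2 / 2) * (1 + l + l ^ 2 / 2) := by nlinarith [sq_nonneg (l ^ 2)]
  have h4 : Real.exp (-l) ≤ 1 - l + l ^ 2 / 2 :=
    le_of_mul_le_mul_right (h2.trans h3) (by positivity)
  linarith

/-- The leading coefficient 1 is what allows the decay rate ρ without loss of a constant factor. -/
theorem sampleLoss_sub_sq_half_le_errorProb (W : Matrix (Fin k) (Fin d) ℝ) :
    sampleLoss x y W - sampleLoss x y W ^ 2 / 2 ≤ errorProb x y W := by
  rw [errorProb_eq]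
  exact sub_sq_half_le_one_sub_exp_neg (sampleLoss_nonneg x y W)

theorem hasDerivAt_sampleLoss (W U : Matrix (Fin k) (Fin d) ℝ) :
    HasDerivAt (fun s : ℝ => sampleLoss x y (W + s • U)) (lossSlope x y W U) 0 := by
  simp only [sampleLoss_eq, logitGap_add, logitGap_smul]
  have h1 : ∀ c, HasDerivAt (fun s : ℝ => Real.exp (logitGap x y W c + s * logitGap x y U c))
      (Real.exp (logitGap x y W c) * logitGap x y U c) 0 := by
    intro c
    have h := (((hasDerivAt_id (0 : ℝ)).mul_const (logitGap x y U c)).const_add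
      (logitGap x y W c)).exp
    simpa using h
  have h2 := HasDerivAt.fun_sum (u := Finset.univ) fun c _ => h1 c
  have h3 := h2.log (by simpa using (sum_exp_pos _ y).ne')
  convert h3 using 1
  rw [lossSlope, Finset.sum_div]
  refine Finset.sum_congr rfl fun c _ => ?_
  rw [softmax_eq_logitGap x y]
  simp only [zero_mul, add_zero]
  ring

theorem matInner_eq_sum (A B : Matrix (Fin k) (Fin d) ℝ) :
    matInner A B = ∑ r, ∑ j, A r j * B r j := by
  simp only [matInner, Matrix.trace, Matrix.diag, Matrix.mul_apply, Matrix.transpose_apply]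
  exact Finset.sum_comm

theorem matInner_matGrad (W U : Matrix (Fin k) (Fin d) ℝ) :
    matInner (matGrad (sampleLoss x y) W) U = lossSlope x y W U := by
  have hU : ∀ c, logitGap x y U c
      = ∑ r, ∑ j, U r j * logitGap x y (Matrix.single r j (1 : ℝ)) c := by
    intro c
    conv_lhs => rw [Matrix.matrix_eq_sum_single U]
    simp only [logitGap_sum]
    refine Finset.sum_congr rfl fun r _ => Finset.sum_congr rfl fun j _ => ?_
    rw [← logitGap_smul, Matrix.smul_single, smul_eq_mul, mul_one]
  rw [matInner_eq_sum]
  simp only [matGrad, Matrix.of_apply, (hasDerivAt_sampleLoss x y W _).deriv, lossSlope]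
  simp_rw [hU, Finset.mul_sum, Finset.sum_mul]
  rw [Finset.sum_comm' (t' := Finset.univ) (s' := fun _ => Finset.univ) (by simp)]
  conv_rhs => rw [Finset.sum_comm]
  rw [Finset.sum_comm]
  refine Finset.sum_congr rfl fun r _ => ?_
  rw [Finset.sum_comm]
  conv_rhs => rw [Finset.sum_comm]
  rw [Finset.sum_comm]
  refine Finset.sum_congr rfl fun j _ => Finset.sum_congr rfl fun c _ => by ring

/-- Moving from `W` to `W + U` changes each softmax probability at most by the factor `exp h`,
if the logits of `U` differ at most by `h`. -/
theorem abs_softmax_div_sub_one_le {W U : Matrix (Fin k) (Fin d) ℝ} {h : ℝ}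
    (hU : ∀ a b, |(U *ᵥ x) a - (U *ᵥ x) b| ≤ h) (c : Fin k) :
    |softmax (W *ᵥ x) c / softmax ((W + U) *ᵥ x) c - 1| ≤ Real.exp h - 1 := by
  have h0 : 0 ≤ h := (abs_nonneg _).trans (hU c c)
  -- The ratio is an average of exp(U_j - U_c) under the softmax distribution of `W`, so bounds on
  -- the exponent carry over.
  have key : softmax (W *ᵥ x) c / softmax ((W + U) *ᵥ x) c
      = ∑ j, softmax (W *ᵥ x) j * Real.exp ((U *ᵥ x) j - (U *ᵥ x) c) := by
    simp only [softmax, Matrix.add_mulVec, Pi.add_apply, Real.exp_add, Real.exp_sub]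
    have h1 := (sum_exp_pos (W *ᵥ x) c).ne'
    have h2 : (∑ j, Real.exp ((W *ᵥ x) j) * Real.exp ((U *ᵥ x) j)) ≠ 0 :=
      (Finset.sum_pos (fun j _ => by positivity) ⟨c, Finset.mem_univ c⟩).ne'
    simp_rw [div_mul_div_comm]
    rw [← Finset.sum_div]
    field_simp
  have hsum := sum_softmax (W *ᵥ x) c
  rw [key, abs_le]
  constructor
  · have h1 : ∑ j, softmax (W *ᵥ x) j * (2 - Real.exp h)
        ≤ ∑ j, softmax (W *ᵥ x) j * Real.exp ((U *ᵥ x) j - (U *ᵥ x) c) := by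
      refine Finset.sum_le_sum fun j _ => mul_le_mul_of_nonneg_left ?_ (softmax_pos _ _).le
      have h2 := (abs_le.1 (hU j c)).1
      have h3 : Real.exp (-h) ≤ Real.exp ((U *ᵥ x) j - (U *ᵥ x) c) := Real.exp_le_exp.2 h2
      -- The lower bound needs 2 - exp h ≤ exp(-h), i.e. exp h + exp(-h) ≥ 2.
      have h4 : Real.exp h * Real.exp (-h) = 1 := by rw [← Real.exp_add]; simp
      nlinarith [Real.exp_pos h, Real.exp_pos (-h), sq_nonneg (Real.exp h - Real.exp (-h)),
        sq_nonneg (Real.exp h + Real.exp (-h) - 2)]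
    rw [← Finset.sum_mul, hsum] at h1
    linarith
  · have h1 : ∑ j, softmax (W *ᵥ x) j * Real.exp ((U *ᵥ x) j - (U *ᵥ x) c)
        ≤ ∑ j, softmax (W *ᵥ x) j * Real.exp h :=
      Finset.sum_le_sum fun j _ => mul_le_mul_of_nonneg_left
        (Real.exp_le_exp.2 (abs_le.1 (hU j c)).2) (softmax_pos _ _).le
    rw [← Finset.sum_mul, hsum] at h1
    linarith

/-- Second order upper bound for the loss, with a remainder proportional to the error
probability. -/
theorem sampleLoss_add_le {W U : Matrix (Fin k) (Fin d) ℝ} {h : ℝ}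
    (hU : ∀ c, |logitGap x y U c| ≤ h) (h1 : h ≤ 1) :
    sampleLoss x y (W + U)
      ≤ sampleLoss x y W + lossSlope x y W U + h ^ 2 * errorProb x y W := by
  set p := softmax (W *ᵥ x) with hp
  set S := ∑ c, Real.exp (logitGap x y W c) with hS
  have hS0 : 0 < S := sum_exp_pos _ y
  have hsum : ∑ c, Real.exp (logitGap x y (W + U) c)
      = S * ∑ c, p c * Real.exp (logitGap x y U c) := by
    rw [Finset.mul_sum]
    refine Finset.sum_congr rfl fun c _ => ?_
    rw [hp, softmax_eq_logitGap x y, logitGap_add, Real.exp_add, ← hS]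
    field_simp
  have hQ : 0 < ∑ c, p c * Real.exp (logitGap x y U c) :=
    Finset.sum_pos (fun c _ => mul_pos (softmax_pos _ _) (Real.exp_pos _)) ⟨y, Finset.mem_univ y⟩
  rw [sampleLoss_eq x y (W + U), hsum, Real.log_mul hS0.ne' hQ.ne', sampleLoss_eq x y W, ← hS]
  -- After log Q ≤ Q - 1 everything is a softmax average of exp g - 1 - g ≤ g². The label has g = 0
  -- and drops out, so the remainder carries the factor `errorProb`.
  have hlog := Real.log_le_sub_one_of_pos hQ
  have hone : (1 : ℝ) = ∑ c, p c := (sum_softmax _ y).symm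
  have hle : ∑ c, p c * Real.exp (logitGap x y U c) - 1 - lossSlope x y W U
      ≤ h ^ 2 * errorProb x y W := by
    nth_rewrite 1 [hone]
    rw [lossSlope, ← hp, ← Finset.sum_sub_distrib, ← Finset.sum_sub_distrib, errorProb,
      Finset.mul_sum, ← Finset.sum_erase_add _ _ (Finset.mem_univ y)]
    simp only [logitGap_self, Real.exp_zero, mul_one, sub_self, mul_zero, add_zero]
    refine Finset.sum_le_sum fun c _ => ?_
    have h2 := Real.abs_exp_sub_one_sub_id_le ((hU c).trans h1)
    have h3 : logitGap x y U c ^ 2 ≤ h ^ 2 := sq_le_sq' (abs_le.1 (hU c)).1 (abs_le.1 (hU c)).2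
    have h4 := mul_le_mul_of_nonneg_left (((le_abs_self _).trans h2).trans h3)
      (softmax_pos (W *ᵥ x) c).le
    rw [← hp] at h4 ⊢
    linarith
  linarith

/-- A perturbed slope differs from the slope at most by the relative size of the perturbation of
the softmax probabilities. -/
theorem abs_sum_softmax_mul_le {W U : Matrix (Fin k) (Fin d) ℝ} {s q : ℝ} {r : Fin k → ℝ}
    (hr : ∀ c, |r c| ≤ q) (hU : ∀ c, |logitGap x y U c| ≤ s) :
    |∑ c, softmax (W *ᵥ x) c * r c * logitGap x y U c| ≤ q * s * errorProb x y W := by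
  rw [← Finset.sum_erase_add _ _ (Finset.mem_univ y)]
  simp only [logitGap_self, mul_zero, add_zero]
  rw [errorProb, Finset.mul_sum]
  refine (Finset.abs_sum_le_sum_abs _ _).trans (Finset.sum_le_sum fun c _ => ?_)
  rw [abs_mul, abs_mul, abs_of_pos (softmax_pos _ _), mul_assoc, mul_comm]
  exact mul_le_mul_of_nonneg_right (mul_le_mul (hr c) (hU c) (abs_nonneg _)
    ((abs_nonneg _).trans (hr c))) (softmax_pos _ _).le

theorem lossSlope_le_of_logitGap_le {W U : Matrix (Fin k) (Fin d) ℝ} {s : ℝ}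
    (hU : ∀ c, c ≠ y → logitGap x y U c ≤ s) :
    lossSlope x y W U ≤ s * errorProb x y W := by
  rw [lossSlope, ← Finset.sum_erase_add _ _ (Finset.mem_univ y)]
  simp only [logitGap_self, mul_zero, add_zero]
  rw [errorProb, Finset.mul_sum]
  refine Finset.sum_le_sum fun c hc => ?_
  rw [mul_comm]
  exact mul_le_mul_of_nonneg_right (hU c (Finset.ne_of_mem_erase hc)) (softmax_pos _ _).le

theorem lossSlope_smul (W U : Matrix (Fin k) (Fin d) ℝ) (s : ℝ) :
    lossSlope x y W (s • U) = s * lossSlope x y W U := by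
  simp only [lossSlope, logitGap_smul, Finset.mul_sum]
  exact Finset.sum_congr rfl fun c _ => by ring

end Sample

end MarginSD

end

/-! ### Step sizes and the lag of the momentum buffer. -/

noncomputable section

namespace MarginSD

section Sequences

open Filter Topology

/-- The effect of the drift of the iterates on a momentum buffer with parameter `β`, when one
step with step size `η t` changes the gradients by a factor of at most `exp (2 * R * η t)`. -/
def momentumLag (β R : ℝ) (η : ℕ → ℝ) : ℕ → ℝ
  | 0 => 0
  | t + 1 => β * Real.exp (2 * R * η t) * momentumLag β R η t
      + β * (Real.exp (2 * R * η t) - 1)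

theorem momentumLag_nonneg {β R : ℝ} {η : ℕ → ℝ} (hβ : 0 ≤ β) (hR : 0 ≤ R)
    (hη : ∀ t, 0 ≤ η t) (t : ℕ) : 0 ≤ momentumLag β R η t := by
  induction t with
  | zero => exact le_rfl
  | succ t ih =>
    have h1 : 1 ≤ Real.exp (2 * R * η t) :=
      Real.one_le_exp (mul_nonneg (mul_nonneg zero_le_two hR) (hη t))
    exact add_nonneg (mul_nonneg (mul_nonneg hβ (Real.exp_pos _).le) ih)
      (mul_nonneg hβ (sub_nonneg.2 h1))

/-- The excess over the fixed point δ/(1 - α) is bounded by a geometric sequence. -/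
theorem eventually_le_of_contraction {u : ℕ → ℝ} {α δ ε : ℝ} (hα₀ : 0 ≤ α) (hα₁ : α < 1)
    (hε : 0 < ε) (h : ∀ᶠ t in atTop, u (t + 1) ≤ α * u t + δ) :
    ∀ᶠ t in atTop, u t ≤ δ / (1 - α) + ε := by
  obtain ⟨T, hT⟩ := eventually_atTop.1 h
  set L := δ / (1 - α) with hL
  have hLα : δ = (1 - α) * L := by rw [hL, mul_div_cancel₀ _ (by linarith)]
  have hind : ∀ s, u (T + s) - L ≤ α ^ s * (u T - L) := by
    intro s
    induction s with
    | zero => simp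
    | succ s ih =>
      have h1 := hT (T + s) (by omega)
      have h2 := mul_le_mul_of_nonneg_left ih hα₀
      rw [← add_assoc, pow_succ']
      linarith
  have hlim : Tendsto (fun s : ℕ => α ^ s * (u T - L)) atTop (𝓝 0) := by
    simpa using (tendsto_pow_atTop_nhds_zero_of_lt_one hα₀ hα₁).mul_const (u T - L)
  obtain ⟨s₀, hs₀⟩ := eventually_atTop.1 (hlim.eventually (gt_mem_nhds hε))
  refine eventually_atTop.2 ⟨T + s₀, fun t ht => ?_⟩
  obtain ⟨s, rfl⟩ := Nat.exists_eq_add_of_le (le_trans (Nat.le_add_right T s₀) ht)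
  linarith [hind s, hs₀ s (by omega)]

variable {c a : ℝ} {η : ℕ → ℝ}

theorem eventually_eq_stepSize (hη : ∀ t : ℕ, 1 ≤ t → η t = c * (t : ℝ) ^ (-a)) :
    (fun t : ℕ => c * (t : ℝ) ^ (-a)) =ᶠ[atTop] η :=
  eventually_atTop.2 ⟨1, fun t ht => (hη t ht).symm⟩

theorem stepSize_pos (hc : 0 < c) (hη : ∀ t : ℕ, 1 ≤ t → η t = c * (t : ℝ) ^ (-a)) {t : ℕ}
    (ht : 1 ≤ t) : 0 < η t := by
  rw [hη t ht]
  have : (0 : ℝ) < t := by exact_mod_cast ht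
  positivity

theorem stepSize_nonneg (hc : 0 < c) (h0 : 0 ≤ η 0)
    (hη : ∀ t : ℕ, 1 ≤ t → η t = c * (t : ℝ) ^ (-a)) (t : ℕ) : 0 ≤ η t := by
  rcases Nat.eq_zero_or_pos t with rfl | ht
  exacts [h0, (stepSize_pos hc hη ht).le]

theorem tendsto_stepSize_zero (ha : 0 < a)
    (hη : ∀ t : ℕ, 1 ≤ t → η t = c * (t : ℝ) ^ (-a)) : Tendsto η atTop (𝓝 0) := by
  refine Tendsto.congr' (eventually_eq_stepSize hη) ?_
  simpa using ((tendsto_rpow_neg_atTop ha).comp tendsto_natCast_atTop_atTop).const_mul c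

theorem tendsto_stepSize_ratio (hc : 0 < c) (hη : ∀ t : ℕ, 1 ≤ t → η t = c * (t : ℝ) ^ (-a)) :
    Tendsto (fun t => η t / η (t + 1)) atTop (𝓝 1) := by
  have h1 : Tendsto (fun t : ℕ => ((t : ℝ) / (t + 1)) ^ (-a)) atTop (𝓝 1) := by
    have h := (tendsto_natCast_div_add_atTop (𝕜 := ℝ) 1).rpow_const (p := -a) (Or.inl one_ne_zero)
    simpa using h
  refine Tendsto.congr' (eventually_atTop.2 ⟨1, fun t ht => ?_⟩) h1
  change _ = η t / η (t + 1)
  rw [hη t ht, hη (t + 1) (by omega), Real.div_rpow (by positivity) (by positivity),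
    mul_div_mul_left _ _ hc.ne']
  push_cast
  rfl

theorem tendsto_sum_stepSize (hc : 0 < c) (ha : a ≤ 1) (h0 : 0 ≤ η 0)
    (hη : ∀ t : ℕ, 1 ≤ t → η t = c * (t : ℝ) ^ (-a)) :
    Tendsto (fun t => ∑ s ∈ Finset.range t, η s) atTop atTop := by
  rw [← not_summable_iff_tendsto_nat_atTop_of_nonneg (stepSize_nonneg hc h0 hη)]
  intro hsum
  have h1 : Summable fun t : ℕ => c * (t : ℝ) ^ (-a) :=
    (summable_congr_atTop (eventually_eq_stepSize hη)).2 hsum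
  rw [summable_mul_left_iff hc.ne', Real.summable_nat_rpow] at h1
  linarith

/-- Since a ≤ 1, the step size is at least c/t, whereas t β^t tends to 0. -/
theorem eventually_const_mul_pow_le_stepSize (hc : 0 < c) (ha : a ≤ 1)
    (hη : ∀ t : ℕ, 1 ≤ t → η t = c * (t : ℝ) ^ (-a)) {β : ℝ} (hβ₀ : 0 ≤ β) (hβ₁ : β < 1)
    (K : ℝ) : ∀ᶠ t in atTop, K * β ^ t ≤ η t := by
  have h1 : Tendsto (fun t : ℕ => K * ((t : ℝ) ^ 1 * β ^ t)) atTop (𝓝 0) := by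
    simpa using (tendsto_pow_const_mul_const_pow_of_lt_one 1 hβ₀ hβ₁).const_mul K
  filter_upwards [h1.eventually (gt_mem_nhds hc), eventually_ge_atTop 1] with t ht h1t
  have ht1 : (1 : ℝ) ≤ t := by exact_mod_cast h1t
  have h2 : c * (t : ℝ) ^ (-1 : ℝ) ≤ η t := by
    rw [hη t h1t]
    exact mul_le_mul_of_nonneg_left (Real.rpow_le_rpow_of_exponent_le ht1 (by linarith)) hc.le
  refine le_trans ?_ h2
  rw [Real.rpow_neg_one, ← div_eq_mul_inv, le_div_iff₀ (by linarith)]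
  rw [pow_one] at ht
  linarith

/-- The quotient lag/η obeys an affine recursion whose factor tends to β, hence is eventually below
(1 + β)/2, with inhomogeneity at most 2R. The fixed point is 4R/(1 - β), and the slack 4R is at most
as large. -/
theorem eventually_momentumLag_le (hc : 0 < c) (ha : 0 < a) (h0 : 0 ≤ η 0)
    (hη : ∀ t : ℕ, 1 ≤ t → η t = c * (t : ℝ) ^ (-a)) {β R : ℝ} (hβ₀ : 0 < β) (hβ₁ : β < 1)
    (hR : 0 < R) : ∀ᶠ t in atTop, momentumLag β R η t ≤ 8 * R / (1 - β) * η t := by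
  have hq : Tendsto (fun t => β * (Real.exp (2 * R * η t) * (η t / η (t + 1)))) atTop (𝓝 β) := by
    have h := ((tendsto_stepSize_zero ha hη).const_mul (2 * R)).rexp.mul
      (tendsto_stepSize_ratio hc hη)
    simpa using h.const_mul β
  have hrec : ∀ᶠ t in atTop, momentumLag β R η (t + 1) / η (t + 1)
      ≤ (1 + β) / 2 * (momentumLag β R η t / η t) + 2 * R := by
    filter_upwards [hq.eventually (gt_mem_nhds (show β < (1 + β) / 2 by linarith)),
      eventually_ge_atTop 1] with t ht h1t
    have hp := stepSize_pos hc hη h1t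
    have hp' := stepSize_pos hc hη (show 1 ≤ t + 1 by omega)
    set q := Real.exp (2 * R * η t) with hqdef
    -- This is exp z - 1 ≤ z exp z, from 1 - z ≤ exp(-z).
    have hq1 : q - 1 ≤ 2 * R * η t * q := by
      have h1 := Real.add_one_le_exp (-(2 * R * η t))
      have h2 : q * Real.exp (-(2 * R * η t)) = 1 := by
        rw [hqdef, ← Real.exp_add]; simp
      nlinarith [mul_le_mul_of_nonneg_left h1 (Real.exp_pos (2 * R * η t)).le]
    have hbq : β * q * η t ≤ (1 + β) / 2 * η (t + 1) := by
      have h3 := mul_le_mul_of_nonneg_right ht.le hp'.le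
      have h4 : β * (q * (η t / η (t + 1))) * η (t + 1) = β * q * η t := by
        field_simp
      linarith
    rw [div_le_iff₀ hp']
    have h5 : 0 ≤ momentumLag β R η t / η t := div_nonneg (momentumLag_nonneg hβ₀.le hR.le (stepSize_nonneg hc h0 hη) t) hp.le
    have h6 : momentumLag β R η t = momentumLag β R η t / η t * η t := by field_simp
    calc momentumLag β R η (t + 1)
        = β * q * momentumLag β R η t + β * (q - 1) := rfl
      _ ≤ β * q * η t * (momentumLag β R η t / η t) + 2 * R * (β * q * η t) := by
        have h7 := mul_le_mul_of_nonneg_left hq1 hβ₀.le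
        nth_rewrite 1 [h6]
        linarith
      _ ≤ (1 + β) / 2 * η (t + 1) * (momentumLag β R η t / η t)
          + 2 * R * ((1 + β) / 2 * η (t + 1)) := by gcongr
      _ ≤ ((1 + β) / 2 * (momentumLag β R η t / η t) + 2 * R) * η (t + 1) := by
        nlinarith [mul_pos hR hp']
  have hbound := eventually_le_of_contraction
    (u := fun t => momentumLag β R η t / η t) (α := (1 + β) / 2) (by linarith) (by linarith)
    (show 0 < 4 * R by linarith) hrec
  filter_upwards [hbound, eventually_ge_atTop 1] with t ht h1t
  have hp := stepSize_pos hc hη h1t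
  rw [div_le_iff₀ hp] at ht
  refine ht.trans (mul_le_mul_of_nonneg_right ?_ hp.le)
  rw [le_div_iff₀ (by linarith), add_mul]
  have h8 : 2 * R / (1 - (1 + β) / 2) * (1 - β) = 4 * R := by
    have h9 : 1 - β ≠ 0 := by linarith
    rw [show 1 - (1 + β) / 2 = (1 - β) / 2 by ring]
    field_simp
    norm_num
  rw [h8]
  nlinarith

end Sequences

/-! ### Exponential averages of visits under reshuffling. -/

section Weights

/-- The total weight that an exponential moving average gives to the times before `t` which are
selected by the indicator `b`. -/
def emaWeight (β : ℝ) (b : ℕ → ℝ) : ℕ → ℝ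
  | 0 => 0
  | t + 1 => β * emaWeight β b t + (1 - β) * b t

variable {β : ℝ} {b : ℕ → ℝ}

theorem emaWeight_nonneg (hβ₀ : 0 ≤ β) (hβ₁ : β ≤ 1) (hb : ∀ t, 0 ≤ b t) (t : ℕ) :
    0 ≤ emaWeight β b t := by
  induction t with
  | zero => exact le_rfl
  | succ t ih => exact add_nonneg (mul_nonneg hβ₀ ih) (mul_nonneg (by linarith) (hb t))

theorem emaWeight_le_one (hβ₀ : 0 ≤ β) (hβ₁ : β ≤ 1) (hb : ∀ t, b t ≤ 1) (t : ℕ) :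
    emaWeight β b t ≤ 1 := by
  induction t with
  | zero => exact zero_le_one
  | succ t ih =>
    change β * emaWeight β b t + (1 - β) * b t ≤ 1
    nlinarith [mul_le_mul_of_nonneg_left ih hβ₀,
      mul_le_mul_of_nonneg_left (hb t) (sub_nonneg.2 hβ₁)]

theorem emaWeight_add_of_single {s m j : ℕ} (hj : b (s + j) = 1)
    (hj' : ∀ i < m, i ≠ j → b (s + i) = 0) {r : ℕ} (hr : r ≤ m) :
    emaWeight β b (s + r) = β ^ r * emaWeight β b s
      + if j < r then (1 - β) * β ^ (r - 1 - j) else 0 := by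
  induction r with
  | zero => simp
  | succ r ih =>
    have h := ih (by omega)
    rw [← add_assoc]
    change β * emaWeight β b (s + r) + (1 - β) * b (s + r) = _
    rw [h]
    rcases lt_trichotomy j r with hlt | rfl | hgt
    · rw [if_pos hlt, if_pos (by omega), hj' r (by omega) (by omega),
        show r + 1 - 1 - j = (r - 1 - j) + 1 by omega]
      ring
    · rw [if_neg (lt_irrefl _), if_pos (Nat.lt_succ_self _), hj, show j + 1 - 1 - j = 0 by omega]
      ring
    · rw [if_neg (by omega), if_neg (by omega), hj' r (by omega) (by omega)]
      ring

/-- Up to an exponentially small term, the weight of a datapoint that is visited once in every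
epoch of length `m` is `1 / m`. -/
theorem abs_mul_emaWeight_sub_one_le {m : ℕ} (hm : 0 < m) (hβ₀ : 0 < β) (hβ₁ : β < 1)
    (hsmall : (1 - β) * m * ((m : ℝ) ^ 2 - 1) ≤ 1)
    (hb : ∀ e : ℕ, ∃ j < m, b (e * m + j) = 1 ∧ ∀ i < m, i ≠ j → b (e * m + i) = 0) (t : ℕ) :
    |m * emaWeight β b t - 1|
      ≤ (1 - β) * m * ((m : ℝ) ^ 2 - 1) / 2 + β ^ t / β ^ m := by
  set ε := 1 - β with hε
  have hε0 : 0 < ε := by linarith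
  have hm1 : (1 : ℝ) ≤ m := by exact_mod_cast hm
  have hpm : β ^ m < 1 := pow_lt_one₀ hβ₀.le hβ₁ hm.ne'
  -- `A` is the fixed point of the epoch map v ↦ β^m v + ε, which belongs to a visit at the end of
  -- each epoch. Visits at the start have the fixed point A β^(m-1). Weights at epoch boundaries lie
  -- between the two, up to the start from 0.
  set A := ε / (1 - β ^ m) with hA
  have hAeq : A * (1 - β ^ m) = ε := div_mul_cancel₀ _ (by linarith)
  have hA0 : 0 < A := div_pos hε0 (by linarith)
  obtain ⟨l, rfl⟩ : ∃ l, m = l + 1 := ⟨m - 1, by omega⟩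
  have hl0 : (0 : ℝ) ≤ l := Nat.cast_nonneg l
  have hbern : 1 - (l : ℝ) * ε ≤ β ^ l := by
    have := one_add_mul_le_pow (show (-2 : ℝ) ≤ β - 1 by linarith) l
    rw [add_sub_cancel] at this
    linarith
  have hbern1 : 1 - β ^ (l + 1) ≤ (l + 1) * ε := by
    have := one_add_mul_le_pow (show (-2 : ℝ) ≤ β - 1 by linarith) (l + 1)
    rw [add_sub_cancel] at this
    push_cast at this
    linarith
  have hpl0 : 0 < β ^ l := pow_pos hβ₀ l
  have hpl1 : β ^ l ≤ 1 := pow_le_one₀ hβ₀.le hβ₁.le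
  have hgeom : ε * ((l + 1) * β ^ l) ≤ 1 - β ^ (l + 1) := by
    rw [← mul_neg_geom_sum]
    refine mul_le_mul_of_nonneg_left ?_ hε0.le
    have h := Finset.card_nsmul_le_sum (Finset.range (l + 1)) (fun i => β ^ i) (β ^ l)
      (fun i hi => pow_le_pow_of_le_one hβ₀.le hβ₁.le (Nat.lt_succ_iff.1 (Finset.mem_range.1 hi)))
    simpa using h
  push_cast at hsmall hm1 ⊢
  -- The argument yields the linear error 3(m - 1)(1 - β). With l = m - 1, this inequality bounds it
  -- by the cubic expression of the statement.
  have hcube : (l : ℝ) * 6 ≤ (l + 1) * ((l + 1) ^ 2 - 1) := by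
    have h1 : (l : ℝ) ≤ l ^ 2 := by
      rcases Nat.eq_zero_or_pos l with rfl | h
      · simp
      · have : (1 : ℝ) ≤ l := by exact_mod_cast h
        nlinarith
    have h2 : (l : ℝ) ≤ l ^ 3 := by
      have : (l : ℝ) * l ≤ l * l ^ 2 := mul_le_mul_of_nonneg_left h1 hl0
      nlinarith
    nlinarith
  have hlε : 2 * (l * ε) ≤ 1 := by nlinarith [mul_le_mul_of_nonneg_left hcube hε0.le]
  have hmA : (l + 1) * A ≤ 1 + 2 * (l * ε) := by
    have h1 : (l + 1) * A * β ^ l ≤ 1 := by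
      have h2 := mul_le_mul_of_nonneg_left hgeom hA0.le
      rw [hAeq] at h2
      exact le_of_mul_le_mul_left (by linarith) hε0
    have h3 : 1 ≤ (1 + 2 * (l * ε)) * β ^ l := by
      have h4 : 0 ≤ (l : ℝ) * ε := by positivity
      nlinarith [mul_le_mul_of_nonneg_left hbern (show 0 ≤ 1 + 2 * (l * ε) by linarith)]
    exact le_of_mul_le_mul_right (h1.trans h3) hpl0
  have hmA' : 1 ≤ (l + 1) * A := by
    have h1 : A * (1 - β ^ (l + 1)) ≤ A * ((l + 1) * ε) := mul_le_mul_of_nonneg_left hbern1 hA0.le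
    rw [hAeq] at h1
    exact le_of_mul_le_mul_left (by linarith) hε0
  have hup : ∀ e : ℕ, emaWeight β b (e * (l + 1)) ≤ A := by
    intro e
    induction e with
    | zero => simpa [emaWeight] using hA0.le
    | succ e ih =>
      obtain ⟨j, hjm, hj, hj'⟩ := hb e
      rw [Nat.succ_mul, emaWeight_add_of_single hj hj' le_rfl, if_pos hjm, ← hε]
      have h1 : ε * β ^ (l + 1 - 1 - j) ≤ ε :=
        mul_le_of_le_one_right hε0.le (pow_le_one₀ hβ₀.le hβ₁.le)
      have h2 := mul_le_mul_of_nonneg_left ih (pow_pos hβ₀ (l + 1)).le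
      linarith
  have hlow : ∀ e : ℕ, A * β ^ l * (1 - β ^ (e * (l + 1))) ≤ emaWeight β b (e * (l + 1)) := by
    intro e
    induction e with
    | zero => simp [emaWeight]
    | succ e ih =>
      obtain ⟨j, hjm, hj, hj'⟩ := hb e
      rw [Nat.succ_mul, emaWeight_add_of_single hj hj' le_rfl, if_pos hjm, ← hε]
      have h1 : ε * β ^ l ≤ ε * β ^ (l + 1 - 1 - j) :=
        mul_le_mul_of_nonneg_left (pow_le_pow_of_le_one hβ₀.le hβ₁.le (by omega)) hε0.le
      have h2 := mul_le_mul_of_nonneg_left ih (pow_pos hβ₀ (l + 1)).le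
      have h3 : A * β ^ l * (1 - β ^ (e * (l + 1) + (l + 1)))
          = β ^ (l + 1) * (A * β ^ l * (1 - β ^ (e * (l + 1))))
            + A * (1 - β ^ (l + 1)) * β ^ l := by
        rw [pow_add β (e * (l + 1))]; ring
      rw [h3, hAeq]
      linarith
  obtain ⟨e, r, hr, rfl⟩ : ∃ e r, r < l + 1 ∧ t = e * (l + 1) + r :=
    ⟨t / (l + 1), t % (l + 1), Nat.mod_lt _ hm, by rw [mul_comm]; exact (Nat.div_add_mod _ _).symm⟩
  obtain ⟨j, hjm, hj, hj'⟩ := hb e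
  have hw := emaWeight_add_of_single (β := β) hj hj' hr.le
  have hv0 : 0 ≤ emaWeight β b (e * (l + 1)) := le_trans (mul_nonneg (by positivity)
    (sub_nonneg.2 (pow_le_one₀ hβ₀.le hβ₁.le))) (hlow e)
  -- The start from weight 0 is forgotten at rate β^m per epoch. Dividing by β^m covers the
  -- unfinished epoch.
  have htail : β ^ (e * (l + 1)) ≤ β ^ (e * (l + 1) + r) / β ^ (l + 1) := by
    rw [le_div_iff₀ (by positivity), ← pow_add]
    exact pow_le_pow_of_le_one hβ₀.le hβ₁.le (by omega)
  have htail0 : 0 < β ^ (e * (l + 1)) := by positivity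
  set v := emaWeight β b (e * (l + 1)) with hv
  rw [abs_le]
  constructor
  · have h1 : β ^ l * v ≤ emaWeight β b (e * (l + 1) + r) := by
      rw [hw]
      have h2 : β ^ l * v ≤ β ^ r * v :=
        mul_le_mul_of_nonneg_right (pow_le_pow_of_le_one hβ₀.le hβ₁.le (by omega)) hv0
      have h3 : 0 ≤ if j < r then (1 - β) * β ^ (r - 1 - j) else 0 := by
        split_ifs
        · exact mul_nonneg hε0.le (by positivity)
        · exact le_rfl
      linarith
    have h4 : β ^ l * (β ^ l * (1 - β ^ (e * (l + 1))))
        ≤ (l + 1) * emaWeight β b (e * (l + 1) + r) := by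
      have hy : 0 ≤ β ^ l * (β ^ l * (1 - β ^ (e * (l + 1)))) :=
        mul_nonneg hpl0.le (mul_nonneg hpl0.le (sub_nonneg.2 (pow_le_one₀ hβ₀.le hβ₁.le)))
      calc β ^ l * (β ^ l * (1 - β ^ (e * (l + 1))))
          ≤ (l + 1) * A * (β ^ l * (β ^ l * (1 - β ^ (e * (l + 1))))) :=
            le_mul_of_one_le_left hy hmA'
        _ = (l + 1) * (β ^ l * (A * β ^ l * (1 - β ^ (e * (l + 1))))) := by ring
        _ ≤ (l + 1) * (β ^ l * v) := by gcongr; exact hlow e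
        _ ≤ _ := by gcongr
    have h5 : 1 - 2 * (l * ε) ≤ β ^ l * β ^ l := by
      have h6 := one_add_mul_le_pow (show (-2 : ℝ) ≤ β - 1 by linarith) (l + l)
      rw [add_sub_cancel, pow_add] at h6
      push_cast at h6
      linarith
    have h7 : β ^ l * β ^ l * β ^ (e * (l + 1)) ≤ β ^ (e * (l + 1)) :=
      mul_le_of_le_one_left htail0.le (mul_le_one₀ hpl1 hpl0.le hpl1)
    have h8 := mul_le_mul_of_nonneg_left hcube hε0.le
    linarith
  · have h8 := mul_le_mul_of_nonneg_left hcube hε0.le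
    have h9 : (l + 1) * emaWeight β b (e * (l + 1) + r) ≤ 1 + 3 * (l * ε) := by
      -- Adding ε to `A` without decay would exceed 1 + 3lε. For r > 0 a factor β is available, and
      -- for r = 0 no visit of the epoch has been counted yet.
      rcases Nat.eq_zero_or_pos r with rfl | hr0
      · have h10 : emaWeight β b (e * (l + 1) + 0) ≤ A := hup e
        have h11 : (0 : ℝ) ≤ l * ε := by positivity
        nlinarith [mul_le_mul_of_nonneg_left h10 (show (0 : ℝ) ≤ l + 1 by linarith)]
      · have hl1 : (1 : ℝ) ≤ l := by exact_mod_cast (show 1 ≤ l by omega)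
        have h12 : emaWeight β b (e * (l + 1) + r) ≤ β * A + ε := by
          rw [hw]
          have h13 : β ^ r * v ≤ β * A := by
            have h14 : β ^ r ≤ β := by
              simpa using pow_le_pow_of_le_one hβ₀.le hβ₁.le hr0
            exact mul_le_mul h14 (hup e) hv0 hβ₀.le
          have h15 : (if j < r then (1 - β) * β ^ (r - 1 - j) else 0) ≤ ε := by
            split_ifs
            · exact mul_le_of_le_one_right hε0.le (pow_le_one₀ hβ₀.le hβ₁.le)
            · exact hε0.le
          linarith
        have h16 : (l + 1) * (β * A + ε) ≤ β * (1 + 2 * (l * ε)) + (l + 1) * ε := by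
          nlinarith [mul_le_mul_of_nonneg_left hmA hβ₀.le]
        have h17 : β * (1 + 2 * (l * ε)) + (l + 1) * ε ≤ 1 + 3 * (l * ε) := by
          have h18 : β = 1 - ε := by rw [hε]; ring
          rw [h18]
          nlinarith [mul_nonneg hl0 (mul_nonneg hε0.le hε0.le)]
        exact (mul_le_mul_of_nonneg_left h12 (by linarith)).trans (h16.trans h17)
    have h19 : 0 < β ^ (e * (l + 1) + r) / β ^ (l + 1) := by positivity
    linarith

end Weights

end MarginSD

end

/-! ### The momentum buffer as a reweighted gradient, and the descent inequality. -/

noncomputable section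

namespace MarginSD

section Momentum

variable {k d n : ℕ}

/-- The average error probability over the data. -/
def avgErrorProb (x : Fin n → Fin d → ℝ) (y : Fin n → Fin k) (W : Matrix (Fin k) (Fin d) ℝ) : ℝ :=
  1 / (n : ℝ) * ∑ i, errorProb (x i) (y i) W

/-- The directional derivative of the empirical loss at `W` in the direction `U`. -/
def avgSlope (x : Fin n → Fin d → ℝ) (y : Fin n → Fin k) (W U : Matrix (Fin k) (Fin d) ℝ) : ℝ :=
  1 / (n : ℝ) * ∑ i, lossSlope (x i) (y i) W U

/-- The indicator of the times at which the datapoint `i` belongs to the current batch. -/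
def visit (B : ℕ → Finset (Fin n)) (i : Fin n) (t : ℕ) : ℝ := if i ∈ B t then 1 else 0

theorem visit_nonneg (B : ℕ → Finset (Fin n)) (i : Fin n) (t : ℕ) : 0 ≤ visit B i t := by
  rw [visit]; split_ifs <;> norm_num

theorem visit_le_one (B : ℕ → Finset (Fin n)) (i : Fin n) (t : ℕ) : visit B i t ≤ 1 := by
  rw [visit]; split_ifs <;> norm_num

theorem IsReshuffling.exists_visit {b m : ℕ} {B : ℕ → Finset (Fin n)} (hB : IsReshuffling b m B)
    (i : Fin n) (e : ℕ) : ∃ j < m, visit B i (e * m + j) = 1 ∧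
      ∀ j' < m, j' ≠ j → visit B i (e * m + j') = 0 := by
  obtain ⟨j, hj, hi⟩ := hB.cover e i
  refine ⟨j, hj, if_pos hi, fun j' hj' hne => if_neg fun hi' => ?_⟩
  exact Finset.disjoint_left.1 (hB.disjoint e j' j hj' hj hne) hi' hi

theorem matInner_add_left (A A' U : Matrix (Fin k) (Fin d) ℝ) :
    matInner (A + A') U = matInner A U + matInner A' U := by
  simp only [matInner_eq_sum, Matrix.add_apply, add_mul, Finset.sum_add_distrib]

theorem matInner_smul_left (s : ℝ) (A U : Matrix (Fin k) (Fin d) ℝ) :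
    matInner (s • A) U = s * matInner A U := by
  simp only [matInner_eq_sum, Matrix.smul_apply, smul_eq_mul, mul_assoc, Finset.mul_sum]

theorem matInner_sum_left {ι : Type*} (S : Finset ι) (A : ι → Matrix (Fin k) (Fin d) ℝ)
    (U : Matrix (Fin k) (Fin d) ℝ) : matInner (∑ i ∈ S, A i) U = ∑ i ∈ S, matInner (A i) U := by
  simp only [matInner, Matrix.transpose_sum, Matrix.sum_mul, Matrix.trace_sum]

variable {x : Fin n → Fin d → ℝ} {y : Fin n → Fin k}

/-- Because 1/b = m/n, a batch gradient is a full gradient in which visited datapoints have weight m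
and the others 0. -/
theorem matInner_batchGrad {b m : ℕ} (hb : 0 < b) (hm : 0 < m) (hn : n = m * b)
    (B : ℕ → Finset (Fin n)) (t : ℕ) (W U : Matrix (Fin k) (Fin d) ℝ) :
    matInner (batchGrad x y b (B t) W) U
      = 1 / (n : ℝ) * ∑ i, ∑ c, softmax (W *ᵥ x i) c * (m * visit B i t)
          * logitGap (x i) (y i) U c := by
  have hb' : (b : ℝ) ≠ 0 := by exact_mod_cast hb.ne'
  have hm' : (m : ℝ) ≠ 0 := by exact_mod_cast hm.ne'
  have hn' : (n : ℝ) = m * b := by exact_mod_cast hn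
  rw [batchGrad, matInner_smul_left, matInner_sum_left]
  simp only [matInner_matGrad]
  rw [hn', ← Finset.sum_ite_mem_eq, Finset.mul_sum, Finset.mul_sum]
  refine Finset.sum_congr rfl fun i _ => ?_
  rw [visit]
  split_ifs
  · rw [lossSlope, Finset.mul_sum, Finset.mul_sum]
    refine Finset.sum_congr rfl fun c _ => ?_
    field_simp
  · simp

variable {N : Matrix (Fin k) (Fin d) ℝ → ℝ} {R : ℝ}

theorem IsEntryControlledNorm.abs_mulVec_sub_le (hN : IsEntryControlledNorm N)
    (hx : ∀ i, ∑ j, |x i j| ≤ R) {U : Matrix (Fin k) (Fin d) ℝ} {s : ℝ} (hU : N U ≤ s) (hs : 0 ≤ s)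
    (i : Fin n) (a b : Fin k) : |(U *ᵥ x i) a - (U *ᵥ x i) b| ≤ 2 * R * s :=
  MarginSD.abs_mulVec_sub_le (hx i) hs (fun r j => (hN.entry_le U r j).trans hU) a b

variable {b m : ℕ} {B : ℕ → Finset (Fin n)} {β : ℝ} {η : ℕ → ℝ}
  {W₀ : Matrix (Fin k) (Fin d) ℝ} {W M Δ : ℕ → Matrix (Fin k) (Fin d) ℝ}

theorem IsMomentumRun.norm_step_le (hN : IsEntryControlledNorm N)
    (hrun : IsMomentumRun N x y b B β η W₀ W M Δ) (hη : ∀ t, 0 ≤ η t) (t : ℕ) :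
    N (-(η t • Δ t)) ≤ η t := by
  rw [hN.neg_eq, hN.smul_eq, abs_of_nonneg (hη t)]
  exact mul_le_of_le_one_right (hη t) (hrun.direction t).1

theorem IsMomentumRun.norm_le (hN : IsEntryControlledNorm N)
    (hrun : IsMomentumRun N x y b B β η W₀ W M Δ) (hη : ∀ t, 0 ≤ η t) (t : ℕ) :
    N (W t) ≤ (∑ r, ∑ j, |W₀ r j|) + ∑ s ∈ Finset.range t, η s := by
  induction t with
  | zero => simpa [hrun.init] using hN.le_sum W₀
  | succ t ih =>
    rw [hrun.step, sub_eq_add_neg, Finset.sum_range_succ]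
    linarith [hN.add_le (W t) (-(η t • Δ t)), hrun.norm_step_le hN hη t]

/-- The momentum buffer is a reweighting of the full gradient at the current iterate; the weights
are controlled by the visits of the datapoints and by the drift of the iterates. -/
theorem IsMomentumRun.exists_momentum_eq (hN : IsEntryControlledNorm N)
    (hrun : IsMomentumRun N x y b B β η W₀ W M Δ) (hx : ∀ i, ∑ j, |x i j| ≤ R)
    (hη : ∀ t, 0 ≤ η t) (hb : 0 < b) (hm : 0 < m) (hn : n = m * b) (hβ₀ : 0 ≤ β) (hβ₁ : β ≤ 1)
    (t : ℕ) :
    ∃ r : Fin n → Fin k → ℝ,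
      (∀ U, matInner (M t) U = 1 / (n : ℝ) * ∑ i, ∑ c, softmax (W t *ᵥ x i) c * r i c
        * logitGap (x i) (y i) U c) ∧
      ∀ i c, |r i c - m * emaWeight β (visit B i) (t + 1)| ≤ m * momentumLag β R η t := by
  induction t with
  | zero =>
    -- `emaWeight` counts strictly earlier times, so the buffer at time t matches index t + 1. At t
    -- = 0 the match is exact, in agreement with a lag of 0.
    refine ⟨fun i c => (1 - β) * (m * visit B i 0), fun U => ?_, fun i c => ?_⟩
    · rw [hrun.momentum_zero, matInner_smul_left, matInner_batchGrad hb hm hn, mul_left_comm,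
        Finset.mul_sum]
      simp only [Finset.mul_sum]
      refine Finset.sum_congr rfl fun i _ => Finset.sum_congr rfl fun c _ => by ring
    · simp only [emaWeight, momentumLag]
      rw [show (1 - β) * (m * visit B i 0) - m * (β * 0 + (1 - β) * visit B i 0) = 0 by ring]
      simp
  | succ t ih =>
    obtain ⟨r, hr, hrlag⟩ := ih
    -- These ratios re-express the old buffer by softmax probabilities at the new iterate, at the
    -- price of multiplying its weights.
    set ρ : Fin n → Fin k → ℝ :=
      fun i c => softmax (W t *ᵥ x i) c / softmax (W (t + 1) *ᵥ x i) c with hρ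
    have hρ1 : ∀ i c, |ρ i c - 1| ≤ Real.exp (2 * R * η t) - 1 := by
      intro i c
      have h := abs_softmax_div_sub_one_le (x i) (W := W t) (U := -(η t • Δ t))
        (fun a a' => hN.abs_mulVec_sub_le hx (hrun.norm_step_le hN hη t) (hη t) i a a') c
      rwa [← sub_eq_add_neg, ← hrun.step] at h
    refine ⟨fun i c => β * (r i c * ρ i c) + (1 - β) * (m * visit B i (t + 1)),
      fun U => ?_, fun i c => ?_⟩
    · rw [hrun.momentum_succ, matInner_add_left, matInner_smul_left, matInner_smul_left,
        matInner_batchGrad hb hm hn, hr]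
      simp only [Finset.mul_sum, ← Finset.sum_add_distrib]
      refine Finset.sum_congr rfl fun i _ => Finset.sum_congr rfl fun c _ => ?_
      have h : softmax (W t *ᵥ x i) c = softmax (W (t + 1) *ᵥ x i) c * ρ i c :=
        (mul_div_cancel₀ _ (softmax_pos _ _).ne').symm
      rw [h]; ring
    · set w := emaWeight β (visit B i) (t + 1) with hw
      have hw0 : 0 ≤ w := emaWeight_nonneg hβ₀ hβ₁ (visit_nonneg B i) _
      have hw1 : w ≤ 1 := emaWeight_le_one hβ₀ hβ₁ (visit_le_one B i) _
      have hm0 : (0 : ℝ) ≤ m := Nat.cast_nonneg m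
      -- The first term propagates the old lag, the second is the fresh drift; together they
      -- reproduce the recursion of `momentumLag`.
      have h1 : β * (r i c * ρ i c) + (1 - β) * (m * visit B i (t + 1))
          - m * emaWeight β (visit B i) (t + 1 + 1)
          = β * ((r i c - m * w) * ρ i c) + β * (m * w * (ρ i c - 1)) := by
        rw [emaWeight]; ring
      have h2 : |ρ i c| ≤ Real.exp (2 * R * η t) := by
        have h3 := abs_add_le (ρ i c - 1) 1
        rw [sub_add_cancel, abs_one] at h3
        linarith [hρ1 i c]
      rw [h1]
      refine (abs_add_le _ _).trans ?_
      rw [abs_mul, abs_mul, abs_mul, abs_mul, abs_of_nonneg hβ₀, abs_of_nonneg (mul_nonneg hm0 hw0)]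
      have h4 : |r i c - m * w| * |ρ i c|
          ≤ m * momentumLag β R η t * Real.exp (2 * R * η t) :=
        mul_le_mul (hrlag i c) h2 (abs_nonneg _) ((abs_nonneg _).trans (hrlag i c))
      have h5 : m * w * |ρ i c - 1| ≤ m * (Real.exp (2 * R * η t) - 1) :=
        mul_le_mul (mul_le_of_le_one_right hm0 hw1) (hρ1 i c) (abs_nonneg _) hm0
      calc _ ≤ β * (m * momentumLag β R η t * Real.exp (2 * R * η t))
            + β * (m * (Real.exp (2 * R * η t) - 1)) := by gcongr
        _ = m * momentumLag β R η (t + 1) := by rw [momentumLag]; ring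

theorem avgErrorProb_nonneg (x : Fin n → Fin d → ℝ) (y : Fin n → Fin k)
    (W : Matrix (Fin k) (Fin d) ℝ) : 0 ≤ avgErrorProb x y W :=
  mul_nonneg (by positivity) (Finset.sum_nonneg fun i _ => errorProb_nonneg _ _ _)

theorem avgErrorProb_le_one (x : Fin n → Fin d → ℝ) (y : Fin n → Fin k)
    (W : Matrix (Fin k) (Fin d) ℝ) : avgErrorProb x y W ≤ 1 := by
  have h1 : ∑ i, errorProb (x i) (y i) W ≤ ∑ _i : Fin n, (1 : ℝ) :=
    Finset.sum_le_sum fun i _ => by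
      rw [errorProb_eq]; linarith [Real.exp_pos (-sampleLoss (x i) (y i) W)]
  rw [Finset.sum_const, Finset.card_univ, Fintype.card_fin, nsmul_eq_mul, mul_one] at h1
  rw [avgErrorProb, one_div_mul_eq_div]
  exact div_le_one_of_le₀ h1 (Nat.cast_nonneg n)

theorem logitGap_le_neg_minMargin (x : Fin n → Fin d → ℝ) (y : Fin n → Fin k)
    (W : Matrix (Fin k) (Fin d) ℝ) (i : Fin n) {c : Fin k} (hc : c ≠ y i) :
    logitGap (x i) (y i) W c ≤ -minMargin x y W := by
  have h := ciInf_le (Set.finite_range fun q : {q : Fin n × Fin k // q.2 ≠ y q.1} =>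
    ((W *ᵥ x q.1.1) (y q.1.1) - (W *ᵥ x q.1.1) q.1.2)).bddBelow ⟨(i, c), hc⟩
  change minMargin x y W ≤ (W *ᵥ x i) (y i) - (W *ᵥ x i) c at h
  rw [logitGap]
  linarith

/-- A momentum buffer whose weights are close to uniform gives a direction whose correlation with
the full gradient is almost as large as the margin allows. -/
theorem IsSteepestDirection.le_avgSlope (hN : IsEntryControlledNorm N)
    (hx : ∀ i, ∑ j, |x i j| ≤ R) {W G U : Matrix (Fin k) (Fin d) ℝ}
    (hU : IsSteepestDirection N G U) {r : Fin n → Fin k → ℝ} {q : ℝ}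
    (hG : ∀ V, matInner G V = 1 / (n : ℝ) * ∑ i, ∑ c, softmax (W *ᵥ x i) c * r i c
      * logitGap (x i) (y i) V c) (hr : ∀ i c, |r i c - 1| ≤ q) :
    (maxMargin N x y - 4 * R * q) * avgErrorProb x y W ≤ avgSlope x y W U := by
  -- This bound is applied both to the chosen direction and to its competitor, so 2Rq becomes 4Rq.
  have happrox : ∀ V, N V ≤ 1 →
      |matInner G V - avgSlope x y W V| ≤ 2 * R * q * avgErrorProb x y W := by
    intro V hV
    have h1 : matInner G V - avgSlope x y W V = 1 / (n : ℝ) * ∑ i, ∑ c,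
        softmax (W *ᵥ x i) c * (r i c - 1) * logitGap (x i) (y i) V c := by
      rw [hG, avgSlope, ← mul_sub, ← Finset.sum_sub_distrib]
      congr 1
      refine Finset.sum_congr rfl fun i _ => ?_
      rw [lossSlope, ← Finset.sum_sub_distrib]
      exact Finset.sum_congr rfl fun c _ => by ring
    rw [h1, abs_mul, abs_of_nonneg (by positivity : (0 : ℝ) ≤ 1 / n), avgErrorProb, mul_left_comm,
      Finset.mul_sum]
    refine mul_le_mul_of_nonneg_left ((Finset.abs_sum_le_sum_abs _ _).trans
      (Finset.sum_le_sum fun i _ => ?_)) (by positivity)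
    have h2 := abs_sum_softmax_mul_le (x i) (y i) (W := W) (hr i)
      (fun c => hN.abs_mulVec_sub_le hx hV zero_le_one i c (y i))
    refine h2.trans_eq (by ring)
  have hE0 := avgErrorProb_nonneg x y W
  have hE1 := avgErrorProb_le_one x y W
  refine le_of_forall_pos_le_add fun ε hε => ?_
  have hne : (minMargin x y '' {W | N W ≤ 1}).Nonempty := by
    refine ⟨_, 0, ?_, rfl⟩
    exact hN.map_zero.le.trans zero_le_one
  -- A nearly optimal classifier suffices. The competitor is -V, since the loss decreases along V
  -- and the iterate moves along -Δ.
  obtain ⟨_, ⟨V, hV, rfl⟩, hVm⟩ := exists_lt_of_lt_csSup hne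
    (show maxMargin N x y - ε < sSup (minMargin x y '' {W | N W ≤ 1}) by
      rw [maxMargin]; linarith)
  have hVneg : N (-V) ≤ 1 := by rw [hN.neg_eq]; exact hV
  have h3 : avgSlope x y W (-V) = -avgSlope x y W V := by
    have h : ∀ i, lossSlope (x i) (y i) W (-V) = -lossSlope (x i) (y i) W V := fun i => by
      simpa using lossSlope_smul (x i) (y i) W V (-1)
    simp only [avgSlope, h, Finset.sum_neg_distrib, mul_neg]
  have h4 : avgSlope x y W V ≤ -(maxMargin N x y - ε) * avgErrorProb x y W := by
    rw [avgSlope, avgErrorProb, mul_left_comm, Finset.mul_sum _ _ (-(maxMargin N x y - ε))]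
    refine mul_le_mul_of_nonneg_left (Finset.sum_le_sum fun i _ => ?_) (by positivity)
    refine lossSlope_le_of_logitGap_le (x i) (y i) fun c hc => ?_
    linarith [logitGap_le_neg_minMargin x y V i hc]
  have h5 := (abs_le.1 (happrox (-V) hVneg)).1
  have h6 := (abs_le.1 (happrox U hU.1)).2
  have h7 := hU.2 (-V) hVneg
  nlinarith

theorem IsMomentumRun.empLoss_succ_le (hN : IsEntryControlledNorm N)
    (hrun : IsMomentumRun N x y b B β η W₀ W M Δ) (hx : ∀ i, ∑ j, |x i j| ≤ R)
    (hη : ∀ t, 0 ≤ η t) {t : ℕ} (ht : 2 * R * η t ≤ 1) :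
    empLoss x y (W (t + 1)) ≤ empLoss x y (W t) - η t * avgSlope x y (W t) (Δ t)
      + (2 * R * η t) ^ 2 * avgErrorProb x y (W t) := by
  have h1 : ∀ i, sampleLoss (x i) (y i) (W (t + 1)) ≤ sampleLoss (x i) (y i) (W t)
      + -η t * lossSlope (x i) (y i) (W t) (Δ t)
      + (2 * R * η t) ^ 2 * errorProb (x i) (y i) (W t) := by
    intro i
    have h := sampleLoss_add_le (x i) (y i) (W := W t) (U := -(η t • Δ t))
      (fun c => hN.abs_mulVec_sub_le hx (hrun.norm_step_le hN hη t) (hη t) i c (y i)) ht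
    rwa [← sub_eq_add_neg, ← hrun.step, ← neg_smul, lossSlope_smul] at h
  have h2 := mul_le_mul_of_nonneg_left (Finset.sum_le_sum (s := Finset.univ) fun i _ => h1 i)
    (by positivity : (0 : ℝ) ≤ 1 / (n : ℝ))
  rw [Finset.sum_add_distrib, Finset.sum_add_distrib, ← Finset.mul_sum, ← Finset.mul_sum] at h2
  rw [empLoss, empLoss, avgSlope, avgErrorProb]
  linarith

theorem maxMargin_le (hN : IsEntryControlledNorm N) (hx : ∀ i, ∑ j, |x i j| ≤ R) {i : Fin n}
    {c : Fin k} (hc : c ≠ y i) (hR : 0 ≤ R) : maxMargin N x y ≤ 2 * R := by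
  refine Real.sSup_le ?_ (by linarith)
  rintro _ ⟨V, hV, rfl⟩
  have h1 := logitGap_le_neg_minMargin x y V i hc
  have h2 := (abs_le.1 (hN.abs_mulVec_sub_le hx hV zero_le_one i c (y i))).1
  rw [logitGap] at h1
  linarith

/-- One step of the descent, once the step size dominates the lag of the momentum buffer. -/
theorem IsMomentumRun.empLoss_succ_le_of_lag_le (hN : IsEntryControlledNorm N)
    (hrun : IsMomentumRun N x y b B β η W₀ W M Δ) (hx : ∀ i, ∑ j, |x i j| ≤ R) (hR : 0 < R)
    (hη : ∀ t, 0 ≤ η t) (hb : 0 < b) (hm : 0 < m) (hn : n = m * b) (hβ₀ : 0 < β) (hβ₁ : β < 1)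
    (hB : IsReshuffling b m B) {ρ : ℝ} (hρ : 0 < ρ)
    (hρeq : ρ = maxMargin N x y - 2 * (1 - β) * m * ((m : ℝ) ^ 2 - 1) * R)
    {i₀ : Fin n} {c₀ : Fin k} (hc₀ : c₀ ≠ y i₀) {t : ℕ}
    (ht : 2 * R * η t ≤ 1) (htail : β ^ (t + 1) / β ^ m ≤ η t)
    (hlag : momentumLag β R η t ≤ 8 * R / (1 - β) * η t) :
    empLoss x y (W (t + 1)) ≤ empLoss x y (W t)
      - η t * (ρ - (4 * R + 36 * R ^ 2) * (m / (1 - β)) * η t) * avgErrorProb x y (W t) := by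
  obtain ⟨r, hr, hrlag⟩ := hrun.exists_momentum_eq hN hx hη hb hm hn hβ₀.le hβ₁.le t
  have hγ := maxMargin_le hN hx hc₀ hR.le
  -- As ρ > 0 and the margin is at most 2R, the effective margin condition itself forces the
  -- smallness that the weight estimate needs.
  have hsmall : (1 - β) * m * ((m : ℝ) ^ 2 - 1) ≤ 1 := by
    have h1 : (1 - β) * m * ((m : ℝ) ^ 2 - 1) * (2 * R) ≤ 1 * (2 * R) := by linarith
    exact le_of_mul_le_mul_right h1 (by linarith)
  have hq : ∀ i c, |r i c - 1| ≤ (1 - β) * m * ((m : ℝ) ^ 2 - 1) / 2 + η t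
      + m * (8 * R / (1 - β) * η t) := by
    intro i c
    have h1 := abs_mul_emaWeight_sub_one_le hm hβ₀ hβ₁ hsmall (hB.exists_visit i) (t + 1)
    have h2 := abs_sub_le (r i c) (m * emaWeight β (visit B i) (t + 1)) 1
    have h3 := mul_le_mul_of_nonneg_left hlag (Nat.cast_nonneg (α := ℝ) m)
    linarith [hrlag i c]
  have hslope := (hrun.direction t).le_avgSlope hN hx hr hq
  have hstep := hrun.empLoss_succ_le hN hx hη ht
  have hE := avgErrorProb_nonneg x y (W t)
  -- With μ ≥ 1 all errors merge into one constant: 4R from the tail, 32R² from the lag and 4R² from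
  -- the second order term.
  have hμ : 1 ≤ (m : ℝ) / (1 - β) := by
    rw [le_div_iff₀ (by linarith)]
    have : (1 : ℝ) ≤ m := by exact_mod_cast hm
    linarith
  have heq : m * (8 * R / (1 - β) * η t) = 8 * R * (m / (1 - β)) * η t := by ring
  rw [heq] at hslope
  set μ := (m : ℝ) / (1 - β) with hμdef
  set E := avgErrorProb x y (W t) with hEdef
  have h5 : (ρ - (4 * R * η t + 32 * R ^ 2 * μ * η t)) * E ≤ avgSlope x y (W t) (Δ t) := by
    refine le_trans (le_of_eq ?_) hslope
    rw [hρeq]; ring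
  have h6 := mul_le_mul_of_nonneg_left h5 (hη t)
  have h7 : 0 ≤ η t ^ 2 * E * (μ - 1) := mul_nonneg (mul_nonneg (sq_nonneg _) hE) (by linarith)
  have h8 : 0 ≤ R * (η t ^ 2 * E * (μ - 1)) := mul_nonneg hR.le h7
  have h9 : 0 ≤ R ^ 2 * (η t ^ 2 * E * (μ - 1)) := mul_nonneg (sq_nonneg R) h7
  linarith

end Momentum

end MarginSD

end

/-! ### Loss, error probability and margin over the whole data set. -/

noncomputable section

namespace MarginSD

section EmpiricalLoss

variable {k d n : ℕ} (x : Fin n → Fin d → ℝ) (y : Fin n → Fin k)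

theorem empLoss_nonneg (W : Matrix (Fin k) (Fin d) ℝ) : 0 ≤ empLoss x y W :=
  mul_nonneg (by positivity) (Finset.sum_nonneg fun i _ => sampleLoss_nonneg _ _ _)

theorem mul_empLoss (hn : 0 < n) (W : Matrix (Fin k) (Fin d) ℝ) :
    n * empLoss x y W = ∑ i, sampleLoss (x i) (y i) W := by
  have : (n : ℝ) ≠ 0 := by exact_mod_cast hn.ne'
  rw [empLoss]
  field_simp

theorem sampleLoss_le_mul_empLoss (hn : 0 < n) (W : Matrix (Fin k) (Fin d) ℝ) (i : Fin n) :
    sampleLoss (x i) (y i) W ≤ n * empLoss x y W := by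
  rw [mul_empLoss x y hn]
  exact Finset.single_le_sum (f := fun i => sampleLoss (x i) (y i) W)
    (fun i _ => sampleLoss_nonneg _ _ _) (Finset.mem_univ i)

/-- Each sample loss is at most nL, so one of the two factors in its square can be replaced by nL
before averaging. -/
theorem empLoss_mul_le_avgErrorProb (hn : 0 < n) (W : Matrix (Fin k) (Fin d) ℝ) :
    empLoss x y W * (1 - n * empLoss x y W / 2) ≤ avgErrorProb x y W := by
  have h1 : ∀ i, sampleLoss (x i) (y i) W * (1 - n * empLoss x y W / 2)
      ≤ errorProb (x i) (y i) W := fun i => by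
    refine le_trans ?_ (sampleLoss_sub_sq_half_le_errorProb (x i) (y i) W)
    nlinarith [mul_le_mul_of_nonneg_left (sampleLoss_le_mul_empLoss x y hn W i)
      (sampleLoss_nonneg (x i) (y i) W)]
  calc empLoss x y W * (1 - n * empLoss x y W / 2)
      = 1 / (n : ℝ) * ∑ i, sampleLoss (x i) (y i) W * (1 - n * empLoss x y W / 2) := by
        rw [← Finset.sum_mul, ← mul_assoc]; rfl
    _ ≤ avgErrorProb x y W :=
        mul_le_mul_of_nonneg_left (Finset.sum_le_sum fun i _ => h1 i) (by positivity)

/-- Some datapoint has at least the average loss, and it alone contributes this much. -/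
theorem le_avgErrorProb_of_lt_empLoss (hn : 0 < n) {W : Matrix (Fin k) (Fin d) ℝ} {τ : ℝ}
    (hτ : τ < empLoss x y W) : (1 - Real.exp (-τ)) / n ≤ avgErrorProb x y W := by
  have hn' : (0 : ℝ) < n := by exact_mod_cast hn
  obtain ⟨i, hi⟩ : ∃ i, τ < sampleLoss (x i) (y i) W := by
    by_contra! h
    have h1 := Finset.sum_le_sum (s := Finset.univ) fun i _ => h i
    rw [← mul_empLoss x y hn, Finset.sum_const, Finset.card_univ, Fintype.card_fin,
      nsmul_eq_mul] at h1
    exact absurd (le_of_mul_le_mul_left h1 hn') (not_le.2 hτ)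
  have h2 : 1 - Real.exp (-τ) ≤ errorProb (x i) (y i) W := by
    rw [errorProb_eq]
    linarith [Real.exp_le_exp.2 (neg_le_neg hi.le)]
  have h3 := Finset.single_le_sum (f := fun i => errorProb (x i) (y i) W)
    (fun i _ => errorProb_nonneg _ _ _) (Finset.mem_univ i)
  rw [avgErrorProb, one_div_mul_eq_div]
  gcongr
  exact h2.trans h3

theorem exp_sub_one_le_div_log_two {l : ℝ} (h0 : 0 ≤ l) (h1 : l ≤ Real.log 2) :
    Real.exp l - 1 ≤ l / Real.log 2 := by
  have h2 : 0 < Real.log 2 := Real.log_pos one_lt_two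
  set s := l / Real.log 2 with hs
  have hs0 : 0 ≤ s := div_nonneg h0 h2.le
  have hs1 : s ≤ 1 := div_le_one_of_le₀ h1 h2.le
  have h3 := convexOn_exp.2 (Set.mem_univ 0) (Set.mem_univ (Real.log 2))
    (sub_nonneg.2 hs1) hs0 (sub_add_cancel 1 s)
  simp only [smul_eq_mul, mul_zero, zero_add, Real.exp_zero, Real.exp_log two_pos] at h3
  rw [show s * Real.log 2 = l from div_mul_cancel₀ _ h2.ne'] at h3
  linarith

/-- For a wrong class, exp(gap) ≤ exp ℓ - 1 ≤ ℓ / log 2 ≤ exp(-X). The middle step is the chord of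
exp over [0, log 2], which is why the threshold is log 2 / n. -/
theorem le_minMargin_of_empLoss_le (hn : 0 < n) (hk : 2 ≤ k) {W : Matrix (Fin k) (Fin d) ℝ} {X : ℝ}
    (h0 : empLoss x y W ≤ Real.log 2 / n)
    (hX : empLoss x y W ≤ Real.log 2 / n * Real.exp (-X)) : X ≤ minMargin x y W := by
  have hn' : (0 : ℝ) < n := by exact_mod_cast hn
  have h2 : 0 < Real.log 2 := Real.log_pos one_lt_two
  have hne : Nonempty {q : Fin n × Fin k // q.2 ≠ y q.1} := by
    have : Nontrivial (Fin k) := Fin.nontrivial_iff_two_le.2 hk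
    obtain ⟨c, hc⟩ := exists_ne (y ⟨0, hn⟩)
    exact ⟨⟨(⟨0, hn⟩, c), hc⟩⟩
  refine le_ciInf fun ⟨⟨i, c⟩, hc⟩ => ?_
  have h3 := exp_logitGap_le (x i) (y i) W hc
  have h4 := sampleLoss_le_mul_empLoss x y hn W i
  have h5 : n * empLoss x y W ≤ Real.log 2 := by
    rw [le_div_iff₀ hn'] at h0; linarith
  have h6 := exp_sub_one_le_div_log_two (sampleLoss_nonneg (x i) (y i) W) (h4.trans h5)
  have h7 : sampleLoss (x i) (y i) W / Real.log 2 ≤ Real.exp (-X) := by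
    rw [div_le_iff₀ h2]
    refine h4.trans ((mul_le_mul_of_nonneg_left hX hn'.le).trans_eq ?_)
    field_simp
  have h8 := Real.exp_le_exp.1 (h3.trans (h6.trans h7))
  rw [logitGap] at h8
  change X ≤ (W *ᵥ x i) (y i) - (W *ᵥ x i) c
  linarith

theorem empLoss_zero (hn : 0 < n) :
    empLoss x y (0 : Matrix (Fin k) (Fin d) ℝ) = Real.log k := by
  have : (n : ℝ) ≠ 0 := by exact_mod_cast hn.ne'
  rw [empLoss]
  simp only [sampleLoss_zero, Finset.sum_const, Finset.card_univ, Fintype.card_fin, nsmul_eq_mul]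
  field_simp

variable {x y} in
theorem IsEntryControlledNorm.empLoss_le {N : Matrix (Fin k) (Fin d) ℝ → ℝ} {R : ℝ}
    (hN : IsEntryControlledNorm N) (hx : ∀ i, ∑ j, |x i j| ≤ R) (hn : 0 < n)
    {W : Matrix (Fin k) (Fin d) ℝ} {s : ℝ} (hW : N W ≤ s) (hs : 0 ≤ s) :
    empLoss x y W ≤ Real.log k + 2 * R * s := by
  have hn' : (0 : ℝ) < n := by exact_mod_cast hn
  have h1 : ∑ i, sampleLoss (x i) (y i) W ≤ ∑ _i : Fin n, (Real.log k + 2 * R * s) :=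
    Finset.sum_le_sum fun i _ => sampleLoss_le_of_logitGap_le (x i) (y i) fun c =>
      (le_abs_self _).trans (hN.abs_mulVec_sub_le hx hW hs i c (y i))
  rw [← mul_empLoss x y hn, Finset.sum_const, Finset.card_univ, Fintype.card_fin,
    nsmul_eq_mul] at h1
  exact le_of_mul_le_mul_left h1 hn'

end EmpiricalLoss

/-! ### Scalar recursions for the loss. -/

section DescentRecursion

variable {L G η : ℕ → ℝ} {ρ κ : ℝ} {T : ℕ}

/-- A loss that keeps decreasing by a definite amount above the threshold `τ` falls below it as
soon as the step sizes have summed up to a given amount. -/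
theorem le_threshold_of_descent {τ g : ℝ} (hτ : 0 ≤ τ) (hρ : 0 ≤ ρ) (hη : ∀ t, 0 ≤ η t)
    (hG : ∀ t, 0 ≤ G t) (hstep : ∀ t, T ≤ t → L (t + 1) ≤ L t - η t * (ρ / 2) * G t)
    (hGτ : ∀ t, τ < L t → g ≤ G t) {t : ℕ} (hTt : T ≤ t)
    (ht : L T ≤ ρ / 2 * g * ∑ s ∈ Finset.Ico T t, η s) : L t ≤ τ := by
  have hind : ∀ t, T ≤ t → L t ≤ τ ∨ L t ≤ L T - ρ / 2 * g * ∑ s ∈ Finset.Ico T t, η s := by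
    intro t hTt
    induction t, hTt using Nat.le_induction with
    | base => right; simp
    | succ t hTt ih =>
      have h1 := hstep t hTt
      have h2 : 0 ≤ η t * (ρ / 2) := mul_nonneg (hη t) (by linarith)
      by_cases hLτ : L t ≤ τ
      · left; linarith [mul_nonneg h2 (hG t)]
      · right
        rw [Finset.sum_Ico_succ_top hTt]
        have h3 := ih.resolve_left hLτ
        have h4 := mul_le_mul_of_nonneg_left (hGτ t (not_le.1 hLτ)) h2
        linarith
  rcases hind t hTt with h | h <;> linarith

/-- Below the threshold `log 2 / n`, the loss decays exponentially in the sum of the step sizes. -/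
theorem exp_decay_of_descent {n : ℕ} (hn : 0 < n) (hρ : 0 ≤ ρ) (hη : ∀ t, 0 ≤ η t)
    (hL : ∀ t, 0 ≤ L t) (hstep : ∀ t, T ≤ t → L (t + 1) ≤ L t - η t * (ρ / 2) * G t)
    (hLG : ∀ t, L t * (1 - n * L t / 2) ≤ G t) (hT : L T ≤ Real.log 2 / n) {t : ℕ} (ht : T ≤ t) :
    L t ≤ Real.log 2 / n * Real.exp (-(ρ / 4) * ∑ s ∈ Finset.Ico T t, η s) := by
  have hn' : (0 : ℝ) < n := by exact_mod_cast hn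
  induction t, ht using Nat.le_induction with
  | base => simpa using hT
  | succ t ht ih =>
    have hτ : L t ≤ Real.log 2 / n := ih.trans (mul_le_of_le_one_right
      (div_nonneg (Real.log_nonneg one_le_two) hn'.le) (Real.exp_le_one_iff.2
        (mul_nonpos_of_nonpos_of_nonneg (by linarith) (Finset.sum_nonneg fun s _ => hη s))))
    have h1 : n * L t ≤ 1 := by
      rw [le_div_iff₀ hn'] at hτ
      linarith [Real.log_two_lt_d9]
    -- One factor 1/2 comes from 1 - nL/2 ≥ 1/2 and one from the step inequality, hence the rate
    -- ρ/4.
    have h2 : L t / 2 ≤ G t := by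
      refine le_trans ?_ (hLG t)
      nlinarith [hL t]
    have h3 := mul_le_mul_of_nonneg_left h2
      (mul_nonneg (hη t) (by linarith : 0 ≤ ρ / 2))
    have h4 := Real.add_one_le_exp (-(ρ / 4) * η t)
    rw [Finset.sum_Ico_succ_top ht, mul_add, Real.exp_add, ← mul_assoc]
    calc L (t + 1) ≤ L t * (-(ρ / 4) * η t + 1) := by linarith [hstep t ht]
      _ ≤ L t * Real.exp (-(ρ / 4) * η t) := mul_le_mul_of_nonneg_left h4 (hL t)
      _ ≤ _ := mul_le_mul_of_nonneg_right ih (Real.exp_pos _).le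

/-- The sharp rate of decay of the loss below the threshold `log 2 / n`. -/
theorem sharp_decay_of_descent {n : ℕ} (hn : 0 < n) (hρ : 0 ≤ ρ) (hκ : 0 ≤ κ) (hη : ∀ t, 0 ≤ η t)
    (hL : ∀ t, 0 ≤ L t) (hκη : ∀ t, T ≤ t → κ * η t ≤ ρ / 2)
    (hstep : ∀ t, T ≤ t → L (t + 1) ≤ L t - η t * (ρ - κ * η t) * G t)
    (hLG : ∀ t, L t * (1 - n * L t / 2) ≤ G t) (hT : L T ≤ Real.log 2 / n)
    (hdecay : ∀ t, T ≤ t →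
      L t ≤ Real.log 2 / n * Real.exp (-(ρ / 4) * ∑ s ∈ Finset.Ico T t, η s)) {t : ℕ} (ht : T ≤ t) :
    L t ≤ Real.log 2 / n * Real.exp (-(ρ * ∑ s ∈ Finset.Ico T t, η s
      - ρ * ∑ s ∈ Finset.Ico T t, η s * Real.exp (-(ρ / 4) * ∑ τ ∈ Finset.Ico T s, η τ)
      - κ * ∑ s ∈ Finset.Ico T t, η s ^ 2)) := by
  have hn' : (0 : ℝ) < n := by exact_mod_cast hn
  induction t, ht using Nat.le_induction with
  | base => simpa using hT
  | succ t ht ih =>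
    set ψ := Real.exp (-(ρ / 4) * ∑ s ∈ Finset.Ico T t, η s) with hψ
    -- The crude decay enters here: it turns the correction nL/2 into the damped sum of step sizes.
    have h1 : n * L t / 2 ≤ ψ := by
      have h2 := mul_le_mul_of_nonneg_left (hdecay t ht) hn'.le
      have h3 : n * (Real.log 2 / n * ψ) = Real.log 2 * ψ := by field_simp
      nlinarith [Real.log_two_lt_d9, Real.exp_pos (-(ρ / 4) * ∑ s ∈ Finset.Ico T t, η s)]
    have h4 : 0 ≤ ρ - κ * η t := by linarith [hκη t ht]
    have h5 := mul_le_mul_of_nonneg_left (hLG t) (mul_nonneg (hη t) h4)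
    have h6 : (ρ - κ * η t) * (1 - n * L t / 2) ≥ ρ - κ * η t - ρ * ψ := by
      have h7 : 0 ≤ n * L t / 2 := by have := hL t; positivity
      nlinarith [mul_nonneg (mul_nonneg hκ (hη t)) h7, mul_le_mul_of_nonneg_left h1 hρ]
    have h8 := mul_le_mul_of_nonneg_left h6 (mul_nonneg (hη t) (hL t))
    have h9 := Real.add_one_le_exp (-(ρ * η t - ρ * (η t * ψ) - κ * η t ^ 2))
    rw [Finset.sum_Ico_succ_top ht, Finset.sum_Ico_succ_top ht, Finset.sum_Ico_succ_top ht, ← hψ]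
    set A := ∑ s ∈ Finset.Ico T t, η s with hA
    set Bs := ∑ s ∈ Finset.Ico T t, η s * Real.exp (-(ρ / 4) * ∑ τ ∈ Finset.Ico T s, η τ) with hB
    set Q := ∑ s ∈ Finset.Ico T t, η s ^ 2 with hQ
    have h10 : -(ρ * (A + η t) - ρ * (Bs + η t * ψ) - κ * (Q + η t ^ 2))
        = -(ρ * A - ρ * Bs - κ * Q) + -(ρ * η t - ρ * (η t * ψ) - κ * η t ^ 2) := by ring
    rw [h10, Real.exp_add, ← mul_assoc]
    calc L (t + 1) ≤ L t * (-(ρ * η t - ρ * (η t * ψ) - κ * η t ^ 2) + 1) := by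
          linarith [hstep t ht]
      _ ≤ L t * Real.exp (-(ρ * η t - ρ * (η t * ψ) - κ * η t ^ 2)) :=
          mul_le_mul_of_nonneg_left h9 (hL t)
      _ ≤ _ := mul_le_mul_of_nonneg_right ih (Real.exp_pos _).le

end DescentRecursion

end MarginSD

end

/-! ### From the decay of the loss to the normalized margin. -/

noncomputable section

namespace MarginSD

section MarginBound

variable {R c a : ℝ} {η : ℕ → ℝ} {β : ℝ}

theorem exists_forall_stepSize_small (hR : 0 < R) (hc : 0 < c) (ha₀ : 0 < a) (ha₁ : a ≤ 1)
    (h0 : 0 ≤ η 0) (hη : ∀ t : ℕ, 1 ≤ t → η t = c * (t : ℝ) ^ (-a)) (hβ₀ : 0 < β) (hβ₁ : β < 1)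
    (m : ℕ) (κ : ℝ) {ε : ℝ} (hε : 0 < ε) :
    ∃ T, ∀ t, T ≤ t → 2 * R * η t ≤ 1 ∧ β ^ (t + 1) / β ^ m ≤ η t ∧
      momentumLag β R η t ≤ 8 * R / (1 - β) * η t ∧ κ * η t ≤ ε := by
  have hη0 := tendsto_stepSize_zero ha₀ hη
  refine Filter.eventually_atTop.1 ?_
  have h1 : Filter.Tendsto (fun t => 2 * R * η t) Filter.atTop (nhds 0) := by
    simpa using hη0.const_mul (2 * R)
  have h2 : Filter.Tendsto (fun t => κ * η t) Filter.atTop (nhds 0) := by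
    simpa using hη0.const_mul κ
  filter_upwards [h1.eventually (ge_mem_nhds one_pos),
    eventually_const_mul_pow_le_stepSize hc ha₁ hη hβ₀.le hβ₁ (β / β ^ m),
    eventually_momentumLag_le hc ha₀ h0 hη hβ₀ hβ₁ hR,
    h2.eventually (ge_mem_nhds hε)] with t ht1 ht2 ht3 ht4
  refine ⟨ht1, le_trans (le_of_eq ?_) ht2, ht3, ht4⟩
  rw [pow_succ]; ring

variable {k d n : ℕ} {N : Matrix (Fin k) (Fin d) ℝ → ℝ} {x : Fin n → Fin d → ℝ} {y : Fin n → Fin k}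
  {b m : ℕ} {B : ℕ → Finset (Fin n)} {W₀ : Matrix (Fin k) (Fin d) ℝ}
  {W M Δ : ℕ → Matrix (Fin k) (Fin d) ℝ}

/-- Loss and margin along a run, from a time `t₂` on which the step sizes are small and have
summed up to a sufficiently large number. -/
theorem IsMomentumRun.empLoss_le_and_le_minMargin (hN : IsEntryControlledNorm N)
    (hrun : IsMomentumRun N x y b B β η W₀ W M Δ) (hx : ∀ i, ∑ j, |x i j| ≤ R) (hR : 0 < R)
    (hη : ∀ t, 0 ≤ η t) (hk : 2 ≤ k) (hb : 0 < b) (hm : 0 < m) (hnpos : 0 < n) (hn : n = m * b)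
    (hβ₀ : 0 < β) (hβ₁ : β < 1) (hB : IsReshuffling b m B) {ρ : ℝ} (hρ : 0 < ρ)
    (hρeq : ρ = maxMargin N x y - 2 * (1 - β) * m * ((m : ℝ) ^ 2 - 1) * R) {κ : ℝ}
    (hκ : κ = (4 * R + 36 * R ^ 2) * (m / (1 - β))) {T t₂ : ℕ}
    (hT : ∀ t, T ≤ t → 2 * R * η t ≤ 1 ∧ β ^ (t + 1) / β ^ m ≤ η t ∧
      momentumLag β R η t ≤ 8 * R / (1 - β) * η t ∧ κ * η t ≤ ρ / 2)
    (hTt₂ : T ≤ t₂)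
    (ht₂ : Real.log k + 2 * R * ((∑ r, ∑ j, |W₀ r j|) + ∑ s ∈ Finset.range T, η s)
      ≤ ρ / 2 * ((1 - Real.exp (-(Real.log 2 / n))) / n) * ∑ s ∈ Finset.Ico T t₂, η s)
    {t : ℕ} (ht : t₂ ≤ t) :
    empLoss x y (W t) ≤ Real.log 2 / n ∧ 0 ≤ minMargin x y (W t) ∧
      ρ * ∑ s ∈ Finset.Ico t₂ t, η s
        - ρ * ∑ s ∈ Finset.Ico t₂ t, η s * Real.exp (-(ρ / 4) * ∑ τ ∈ Finset.Ico t₂ s, η τ)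
        - κ * ∑ s ∈ Finset.Ico t₂ t, η s ^ 2 ≤ minMargin x y (W t) := by
  have hlog2 : 0 < Real.log 2 := Real.log_pos one_lt_two
  have hτ : 0 ≤ Real.log 2 / (n : ℝ) := div_nonneg hlog2.le (Nat.cast_nonneg n)
  have hκ0 : 0 ≤ κ := by
    rw [hκ]
    exact mul_nonneg (by positivity) (div_nonneg (Nat.cast_nonneg m) (by linarith))
  obtain ⟨c₀, hc₀⟩ : ∃ c₀, c₀ ≠ y ⟨0, hnpos⟩ := by
    have : Nontrivial (Fin k) := Fin.nontrivial_iff_two_le.2 hk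
    exact exists_ne _
  have hTt : ∀ s, t₂ ≤ s → T ≤ s := fun s hs => hTt₂.trans hs
  have hLnn : ∀ t, 0 ≤ empLoss x y (W t) := fun t => empLoss_nonneg x y (W t)
  have hGnn : ∀ t, 0 ≤ avgErrorProb x y (W t) := fun t => avgErrorProb_nonneg x y (W t)
  have hLG : ∀ t, empLoss x y (W t) * (1 - n * empLoss x y (W t) / 2) ≤ avgErrorProb x y (W t) :=
    fun t => empLoss_mul_le_avgErrorProb x y hnpos (W t)
  have hstep : ∀ t, T ≤ t → empLoss x y (W (t + 1))
      ≤ empLoss x y (W t) - η t * (ρ - κ * η t) * avgErrorProb x y (W t) := by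
    intro t ht
    obtain ⟨h1, h2, h3, -⟩ := hT t ht
    rw [hκ]
    exact hrun.empLoss_succ_le_of_lag_le hN hx hR hη hb hm hn hβ₀ hβ₁ hB hρ hρeq hc₀ h1 h2 h3
  have hstep' : ∀ t, T ≤ t → empLoss x y (W (t + 1))
      ≤ empLoss x y (W t) - η t * (ρ / 2) * avgErrorProb x y (W t) := by
    intro t ht
    have h1 : η t * (ρ / 2) ≤ η t * (ρ - κ * η t) :=
      mul_le_mul_of_nonneg_left (by linarith [(hT t ht).2.2.2]) (hη t)
    linarith [hstep t ht, mul_le_mul_of_nonneg_right h1 (hGnn t)]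
  have hL : ∀ t, t₂ ≤ t → empLoss x y (W t) ≤ Real.log 2 / n := by
    intro t ht
    refine le_threshold_of_descent (L := fun t => empLoss x y (W t))
      (G := fun t => avgErrorProb x y (W t)) hτ hρ.le hη hGnn hstep'
      (fun t h => le_avgErrorProb_of_lt_empLoss x y hnpos h) (hTt t ht) ?_
    -- The loss at time `T` is bounded through `k`, `R`, `W₀` and the step sizes only, so the
    -- waiting time can be fixed before the data, the norm and the batches are known.
    refine (hN.empLoss_le hx hnpos (hrun.norm_le hN hη T) (add_nonneg (Finset.sum_nonneg fun r _ =>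
      Finset.sum_nonneg fun j _ => abs_nonneg _) (Finset.sum_nonneg fun s _ => hη s))).trans
      (ht₂.trans (mul_le_mul_of_nonneg_left ?_ ?_))
    · exact Finset.sum_le_sum_of_subset_of_nonneg (Finset.Ico_subset_Ico_right ht)
        fun s _ _ => hη s
    · have h1 : Real.exp (-(Real.log 2 / n)) ≤ 1 := Real.exp_le_one_iff.2 (by linarith)
      exact mul_nonneg (by linarith) (div_nonneg (by linarith) (Nat.cast_nonneg n))
  -- Nonnegativity of the margin is the case X = 0.
  refine ⟨hL t ht, le_minMargin_of_empLoss_le x y hnpos hk (hL t ht) (by simpa using hL t ht),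
    le_minMargin_of_empLoss_le x y hnpos hk (hL t ht) ?_⟩
  exact sharp_decay_of_descent (L := fun t => empLoss x y (W t))
    (G := fun t => avgErrorProb x y (W t)) hnpos hρ.le hκ0 hη hLnn
    (fun s hs => (hT s (hTt s hs)).2.2.2) (fun s hs => hstep s (hTt s hs)) hLG (hL t₂ le_rfl)
    (fun s hs => exp_decay_of_descent hnpos hρ.le hη hLnn (fun t ht => hstep' t (hTt t ht)) hLG
      (hL t₂ le_rfl) hs) ht

/-- The zero matrix has loss log k, which exceeds log 2 / n when n ≥ 2. This makes the normalized
margin meaningful. -/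
theorem IsEntryControlledNorm.pos_of_empLoss_le (hN : IsEntryControlledNorm N) (hk : 2 ≤ k)
    (hn : 2 ≤ n) {V : Matrix (Fin k) (Fin d) ℝ} (hV : empLoss x y V ≤ Real.log 2 / n) :
    0 < N V := by
  refine lt_of_le_of_ne (hN.nonneg V) fun h => ?_
  have hn' : (2 : ℝ) ≤ n := by exact_mod_cast hn
  have hlog2 : 0 < Real.log 2 := Real.log_pos one_lt_two
  rw [hN.eq_zero_of_map_eq_zero h.symm, empLoss_zero x y (by omega), le_div_iff₀ (by linarith)] at hV
  have h2 : Real.log 2 ≤ Real.log k := Real.log_le_log two_pos (by exact_mod_cast hk)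
  nlinarith

/-- Here `A` bounds the initial norm, and `S` and `H` are the sums of the step sizes up to `t₂` and
up to t. A nonnegative margin allows the norm to be replaced by A + H. The 2ρ collects ρA ≤ ρS and
the ρS lost before `t₂`; of `D` only nonnegativity matters. -/
theorem normalized_margin_gap_le {ρ K μ A H S E Q D margin nrm : ℝ} (hρ : 0 ≤ ρ) (hK : 0 ≤ K)
    (hμ : 0 ≤ μ) (hA : 0 ≤ A) (hAS : A ≤ S) (hE : 0 ≤ E) (hQ : 0 ≤ Q) (hD : 0 ≤ D) (hH : 0 < H)
    (hnrm : 0 < nrm) (hnrm' : nrm ≤ A + H) (hm0 : 0 ≤ margin)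
    (hm : ρ * (H - S) - ρ * E - K * μ * Q ≤ margin) :
    ρ - margin / nrm ≤ (2 * ρ + K) * ((S + μ * Q + E + D) / H) := by
  have hS : 0 ≤ S := hA.trans hAS
  have hμQ : 0 ≤ μ * Q := mul_nonneg hμ hQ
  have hnum : 0 ≤ (2 * ρ + K) * (S + μ * Q + E + D) := by positivity
  have h1 : margin / (A + H) ≤ margin / nrm := div_le_div_of_nonneg_left hm0 hnrm hnrm'
  have h2 : ρ * (A + H) - margin ≤ (2 * ρ + K) * (S + μ * Q + E + D) := by
    linarith [mul_nonneg hρ hμQ, mul_nonneg hρ hE, mul_nonneg hρ hD, mul_nonneg hK hE,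
      mul_nonneg hK hD, mul_nonneg hK hS, mul_le_mul_of_nonneg_left hAS hρ]
  calc ρ - margin / nrm ≤ ρ - margin / (A + H) := by linarith
    _ = (ρ * (A + H) - margin) / (A + H) := by
      have : A + H ≠ 0 := by linarith
      field_simp
    _ ≤ (2 * ρ + K) * (S + μ * Q + E + D) / (A + H) := by gcongr
    _ ≤ (2 * ρ + K) * (S + μ * Q + E + D) / H :=
      div_le_div_of_nonneg_left hnum hH (by linarith)
    _ = (2 * ρ + K) * ((S + μ * Q + E + D) / H) := mul_div_assoc _ _ _

end MarginBound

end MarginSD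

end

/-! ### The theorem. -/

theorem theorem4p3 (R c a ρ : ℝ) (hR : 0 < R) (hc : 0 < c) (ha₀ : 0 < a) (ha₁ : a ≤ 1)
    (hρ : 0 < ρ) :
    ∃ C : ℝ, 0 < C ∧
      ∀ (k d n b m : ℕ) (β₁ γ : ℝ) (W₀ : Matrix (Fin k) (Fin d) ℝ) (η : ℕ → ℝ),
        2 ≤ k → 0 < b → n = m * b → 0 < β₁ → β₁ < 1 →
        ρ = γ - 2 * (1 - β₁) * (m : ℝ) * ((m : ℝ) ^ 2 - 1) * R →
        0 ≤ η 0 → η 0 ≤ c → (∀ t : ℕ, 1 ≤ t → η t = c * (t : ℝ) ^ (-a)) →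
        ∃ t₂ : ℕ,
          ∀ (κ : MarginSD.NormKind) (p : ENNReal), 1 ≤ p →
          ∀ (x : Fin n → Fin d → ℝ) (y : Fin n → Fin k),
            Function.Surjective y →
            MarginSD.LinearlySeparable x y →
            (∀ i, ∑ j, |x i j| ≤ R) →
            MarginSD.maxMargin (MarginSD.matNorm κ p) x y = γ →
          ∀ (B : ℕ → Finset (Fin n)), MarginSD.IsReshuffling b m B →
          ∀ (W M Δ : ℕ → Matrix (Fin k) (Fin d) ℝ),
            MarginSD.IsMomentumRun (MarginSD.matNorm κ p) x y b B β₁ η W₀ W M Δ →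
          ∀ t : ℕ, t₂ < t →
            MarginSD.empLoss x y (W t) ≤ Real.log 2 / (n : ℝ) ∧
            ρ - MarginSD.minMargin x y (W t) / MarginSD.matNorm κ p (W t) ≤
              C * ((∑ s ∈ Finset.range t₂, η s
                    + (m : ℝ) / (1 - β₁) * ∑ s ∈ Finset.Ico t₂ t, η s ^ 2
                    + ∑ s ∈ Finset.Ico t₂ t,
                        η s * Real.exp (-(ρ / 4) * ∑ τ ∈ Finset.Ico t₂ s, η τ)
                    + 4 * R * η 0 / (1 - Real.sqrt β₁))
                  / ∑ s ∈ Finset.range t, η s) := by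
  refine ⟨2 * ρ + (4 * R + 36 * R ^ 2), by positivity, ?_⟩
  intro k d n b m β₁ γ W₀ η hk hb hn hβ₀ hβ₁ hρeq h0 _ hη
  rcases Nat.eq_zero_or_pos n with hn0 | hnpos
  -- Without datapoints no labelling can be surjective onto two or more classes.
  · refine ⟨0, fun _ _ _ _ y hy => ?_⟩
    obtain ⟨i, -⟩ := hy ⟨0, by omega⟩
    exact absurd i.pos (by omega)
  have hm : 0 < m := Nat.pos_of_ne_zero fun h => by simp [h] at hn; omega
  have hn' : (0 : ℝ) < n := by exact_mod_cast hnpos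
  have hηnn := MarginSD.stepSize_nonneg hc h0 hη
  have hg : 0 < ρ / 2 * ((1 - Real.exp (-(Real.log 2 / n))) / n) := by
    have h1 : Real.exp (-(Real.log 2 / n)) < 1 :=
      Real.exp_lt_one_iff.2 (neg_neg_of_pos (div_pos (Real.log_pos one_lt_two) hn'))
    exact mul_pos (half_pos hρ) (div_pos (by linarith) hn')
  obtain ⟨T, hT⟩ := MarginSD.exists_forall_stepSize_small hR hc ha₀ ha₁ h0 hη hβ₀ hβ₁ m
    ((4 * R + 36 * R ^ 2) * (m / (1 - β₁))) (half_pos hρ)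
  -- The three demands: t > t₂ implies t ≥ 2, the initial norm is absorbed by the first sum of the
  -- bound, and the steps after `T` suffice to push the loss below the threshold.
  obtain ⟨t₂, hTt₂, ht₂N, ht₂⟩ : ∃ t₂, T + 1 ≤ t₂ ∧
      ∑ r, ∑ j, |W₀ r j| ≤ ∑ s ∈ Finset.range t₂, η s ∧
      ∑ s ∈ Finset.range T, η s
        + (Real.log k + 2 * R * ((∑ r, ∑ j, |W₀ r j|) + ∑ s ∈ Finset.range T, η s))
          / (ρ / 2 * ((1 - Real.exp (-(Real.log 2 / n))) / n)) ≤ ∑ s ∈ Finset.range t₂, η s := by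
    have h := MarginSD.tendsto_sum_stepSize hc ha₁ h0 hη
    exact ((Filter.eventually_ge_atTop (T + 1)).and ((h.eventually_ge_atTop _).and
      (h.eventually_ge_atTop _))).exists
  refine ⟨t₂, fun κ p hp x y hy _ hx hγ B hB W M Δ hrun t ht => ?_⟩
  have hN := MarginSD.isEntryControlledNorm_matNorm κ hp (k := k) (d := d)
  have hkn : k ≤ n := by simpa using Fintype.card_le_of_surjective y hy
  obtain ⟨hL, hm0, hmargin⟩ := hrun.empLoss_le_and_le_minMargin hN hx hR hηnn hk hb hm hnpos hn
    hβ₀ hβ₁ hB hρ (by rw [hγ]; exact hρeq) rfl hT (by omega) (by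
      rw [Finset.sum_Ico_eq_sub _ (show T ≤ t₂ by omega), ← div_le_iff₀' hg]
      linarith) ht.le
  refine ⟨hL, ?_⟩
  rw [Finset.sum_Ico_eq_sub _ ht.le] at hmargin
  refine MarginSD.normalized_margin_gap_le hρ.le (by positivity)
    (div_nonneg (Nat.cast_nonneg m) (by linarith))
    (Finset.sum_nonneg fun r _ => Finset.sum_nonneg fun j _ => abs_nonneg _) ht₂N
    (Finset.sum_nonneg fun s _ => mul_nonneg (hηnn s) (Real.exp_pos _).le)
    (Finset.sum_nonneg fun s _ => sq_nonneg _) ?_ ?_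
    (hN.pos_of_empLoss_le hk (hk.trans hkn) hL) (hrun.norm_le hN hηnn t) hm0 hmargin
  · exact div_nonneg (mul_nonneg (by positivity) h0)
      (sub_nonneg.2 (Real.sqrt_le_one.2 hβ₁.le))
  -- The index 1 is used because η 0 may vanish.
  · exact Finset.sum_pos' (fun s _ => hηnn s) ⟨1, Finset.mem_range.2 (by omega),
      MarginSD.stepSize_pos hc hη le_rfl⟩
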